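/- Work on $\mathbb{R}^2$. Let $k,\ell\ge 0$ be integers with $k\ge 1$ or $k=\ell=0$, and let $f\in C_c^\infty(S^k\times S^\ell)$ be a smooth compactly supported (real or complex) tensor field $f_{i_1\dots i_k j_1\dots j_\ell}$, all indices in $\{1,2\}$, symmetric in its first $k$ and in its last $\ell$ indices. For $\xi=(\xi_1,\xi_2)\in\mathbb{S}^1$ put $\eta=(-\xi_2,\xi_1)$ and (summing over repeated indices) let $$L_{k,\ell}f(x,\xi)=\int_{-\infty}^{\infty} f_{i_1\dots i_kj_1\dots j_\ell}(x+t\xi)\,\xi^{i_1}\cdots\xi^{i_k}\eta^{j_1}\cdots\eta^{j_\ell}\,dt,\qquad \langle x,\xi\rangle=0,$$ be the mixed ray transform, let $$(L_{k,\ell}^*g)_{i_1\dots i_kj_1\dots j_\ell}(x)=\int_{\mathbb{S}^1}\xi^{i_1}\cdots\xi^{i_k}\eta^{j_1}\cdots\eta^{j_\ell}\,g(x-\langle x,\xi\rangle\xi,\xi)\,dS_\xi$$ be its formal $L^2$ adjoint, and let $N_{k,\ell}=L_{k,\ell}^*L_{k,\ell}$ be the normal operator. Define $(\mathrm d'u)_{i_1\dots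 i_kj_1\dots j_\ell}=\sigma(i_1,\dots,i_k)\,\partial_{i_1}u_{i_2\dots i_kj_1\dots j_\ell}$, $(\lambda w)_{i_1\dots i_kj_1\dots j_\ell}=\sigma(i_1,\dots,i_k)\sigma(j_1,\dots,j_\ell)\,\delta_{i_1j_1}w_{i_2\dots i_kj_2\dots j_\ell}$, $(\delta'h)_{i_2\dots i_kj_1\dots j_\ell}=\partial_{i_1}h_{i_1\dots i_kj_1\dots j_\ell}$ and $(\mu h)_{i_2\dots i_kj_2\dots j_\ell}=\delta^{i_1j_1}h_{i_1\dots i_kj_1\dots j_\ell}$, where $\sigma$ denotes symmetrization over the indicated indices. (Terms and conditions that refer to an empty group of indices are absent: $\mathrm d'$ and $\delta'$ if $k=0$, $\lambda$ and $\mu$ if $k=0$ or $\ell=0$.) Then there is exactly one field $f^s\in C^\infty(S^k\times S^\ell)$ with $$f=f^s+\mathrm d'u+\lambda w,\qquad \delta'f^s=0,\quad \mu f^s=0,\quad \mu u=0,\quad f^s,u\to0\ \text{ as }|x|\to\infty,$$ for some $u\in C^\infty(S^{k-1}\times S^\ell)$ and $w\in C^\infty(S^{k-1}\times S^{\ell-1})$,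 and each of its components is recovered from the single component $(N_{k,\ell}f)_{1\cdots1\,1\cdots1}$ by $$f^s_{m_1\dots m_kn_1\dots n_\ell}=\frac{(-1)^{M_2}}{4\pi}\,(-\Delta)^{1/2}\,\bigl(D_{x_1}^{N_2}D_{x_2}^{M_2}\bigr)^{-1}D_{x_1}^{M_2}D_{x_2}^{N_2}\,(N_{k,\ell}f)_{1\cdots1\,1\cdots1},$$ where $D=\frac1{\mathrm i}\partial$, $M_2$ is the number of $2$'s among $m_1,\dots,m_k$ and $N_2$ is the number of $2$'s among $n_1,\dots,n_\ell$. The operator on the right is the Fourier multiplier with the almost everywhere defined symbol $\frac{(-1)^{M_2}}{4\pi}|y|\,(y_1/y_2)^{M_2-N_2}$. That is, the tempered distribution $(N_{k,\ell}f)_{1\cdots1\,1\cdots1}$ has a Fourier transform that is a locally integrable function $G(y)$, the product of $G$ with this symbol is again a locally integrable tempered function, and this product is the Fourier transform of $f^s_{m_1\dots m_kn_1\dots n_\ell}$. -/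

import Mathlib

open scoped ContDiff SchwartzMap FourierTransform BigOperators

namespace MixedRay

/-- The Euclidean plane `ℝ²`; the coordinates `x₁`, `x₂` are `x 0`, `x 1`. -/
abbrev Plane := EuclideanSpace ℝ (Fin 2)

/-- A tuple of `n` tensor indices. The index values `1`, `2` are written `0`, `1` here. -/
abbrev Idx (n : ℕ) := Fin n → Fin 2

/-- A field of `(k + ℓ)`-tensors on the plane, given by its components
`f_{i₁ … i_k j₁ … j_ℓ}`. -/
abbrev TField (k ℓ : ℕ) := Idx k → Idx ℓ → Plane → ℂ

/-- Membership in `C^∞(S^k × S^ℓ)`: the components are smooth and the field is symmetric in its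
first `k` and in its last `ℓ` indices. -/
structure IsSmoothSym {k ℓ : ℕ} (f : TField k ℓ) : Prop where
  smooth : ∀ i j, ContDiff ℝ ∞ (f i j)
  symm_left : ∀ (π : Equiv.Perm (Fin k)) (i : Idx k) (j : Idx ℓ), f (i ∘ π) j = f i j
  symm_right : ∀ (π : Equiv.Perm (Fin ℓ)) (i : Idx k) (j : Idx ℓ), f i (j ∘ π) = f i j

/-- Membership in `C_c^∞(S^k × S^ℓ)`. -/
structure IsSmoothSymCompact {k ℓ : ℕ} (f : TField k ℓ) : Prop extends IsSmoothSym f where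
  compact : ∀ i j, HasCompactSupport (f i j)

/-- All components tend to zero as `|x| → ∞`. -/
def VanishesAtInfinity {k ℓ : ℕ} (f : TField k ℓ) : Prop :=
  ∀ i j, Filter.Tendsto (f i j) (Filter.cocompact Plane) (nhds 0)

/-- The partial derivative `∂ h / ∂ x^a`. -/
noncomputable def pd (a : Fin 2) (h : Plane → ℂ) (x : Plane) : ℂ :=
  fderiv ℝ h x (EuclideanSpace.single a 1)

/-- `d' : C^∞(S^k × S^ℓ) → C^∞(S^{k+1} × S^ℓ)`, the derivative symmetrized over the first
group of indices: `(d' u)_{i j} = σ(i₁, …, i_{k+1}) ∂_{i₁} u_{i₂ … i_{k+1} j}`. -/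
noncomputable def dPrime {k ℓ : ℕ} (u : TField k ℓ) : TField (k + 1) ℓ := fun i j x =>
  (1 / ((k + 1).factorial : ℂ)) *
    ∑ π : Equiv.Perm (Fin (k + 1)), pd (i (π 0)) (u (fun a => i (π a.succ)) j) x

/-- `δ' : C^∞(S^{k+1} × S^ℓ) → C^∞(S^k × S^ℓ)`, the divergence over the first group of indices. -/
noncomputable def divPrime {k ℓ : ℕ} (f : TField (k + 1) ℓ) : TField k ℓ := fun i j x =>
  ∑ a : Fin 2, pd a (f (Fin.cons a i) j) x

/-- `λ : C^∞(S^k × S^ℓ) → C^∞(S^{k+1} × S^{ℓ+1})`,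
`(λ w)_{i j} = σ(i) σ(j) δ_{i₁ j₁} w_{i₂ … i_{k+1} j₂ … j_{ℓ+1}}`. -/
noncomputable def lam {k ℓ : ℕ} (w : TField k ℓ) : TField (k + 1) (ℓ + 1) := fun i j x =>
  (1 / ((k + 1).factorial : ℂ)) * (1 / ((ℓ + 1).factorial : ℂ)) *
    ∑ π : Equiv.Perm (Fin (k + 1)), ∑ ρ : Equiv.Perm (Fin (ℓ + 1)),
      if i (π 0) = j (ρ 0) then w (fun a => i (π a.succ)) (fun b => j (ρ b.succ)) x else 0

/-- `μ : C^∞(S^{k+1} × S^{ℓ+1}) → C^∞(S^k × S^ℓ)`, the trace over one index of the first group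
and one of the second (on symmetric fields it does not matter which). -/
def trace {k ℓ : ℕ} (f : TField (k + 1) (ℓ + 1)) : TField k ℓ := fun i j x =>
  ∑ a : Fin 2, f (Fin.cons a i) (Fin.cons a j) x

/-- `δ' f = 0` (no condition if the first group of indices is empty). -/
def IsDivFree : {k ℓ : ℕ} → TField k ℓ → Prop
  | _ + 1, _, f => divPrime f = 0
  | 0, _, _ => True

/-- `μ f = 0` (no condition if one of the two groups of indices is empty). -/
def IsTraceFree : {k ℓ : ℕ} → TField k ℓ → Prop
  | _ + 1, _ + 1, f => trace f = 0
  | _ + 1, 0, _ => True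
  | 0, _, _ => True

/-- `p = d' u` with `u ∈ C^∞(S^{k-1} × S^ℓ)`, `μ u = 0` and `u → 0` at infinity; for `k = 0` the
space of potentials is zero. -/
def IsPotential : {k ℓ : ℕ} → TField k ℓ → Prop
  | k + 1, ℓ, p => ∃ u : TField k ℓ,
      IsSmoothSym u ∧ IsTraceFree u ∧ VanishesAtInfinity u ∧ p = dPrime u
  | 0, _, p => p = 0

/-- `q = λ w` with `w ∈ C^∞(S^{k-1} × S^{ℓ-1})`; for `k = 0` or `ℓ = 0` the space of such
fields is zero. -/
def IsLam : {k ℓ : ℕ} → TField k ℓ → Prop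
  | k + 1, ℓ + 1, q => ∃ w : TField k ℓ, IsSmoothSym w ∧ q = lam w
  | _ + 1, 0, q => q = 0
  | 0, _, q => q = 0

/-- `fs` is the solenoidal part `f^s` of `f` : `f = f^s + d' u + λ w` with
`δ' f^s = μ f^s = 0`, `μ u = 0` and `f^s, u → 0` at infinity. -/
def IsSolenoidalPart {k ℓ : ℕ} (f fs : TField k ℓ) : Prop :=
  IsSmoothSym fs ∧ IsDivFree fs ∧ IsTraceFree fs ∧ VanishesAtInfinity fs ∧
    ∃ p q : TField k ℓ, IsPotential p ∧ IsLam q ∧ f = fs + p + q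

/-- `ξ^⊥ = (-ξ₂, ξ₁)`. -/
noncomputable def perp (ξ : Plane) : Plane := !₂[-ξ 1, ξ 0]

/-- `ξ^{i₁} ⋯ ξ^{i_k} η^{j₁} ⋯ η^{j_ℓ}` with `η = ξ^⊥`. -/
noncomputable def mono {k ℓ : ℕ} (ξ : Plane) (i : Idx k) (j : Idx ℓ) : ℂ :=
  (((∏ a, ξ (i a)) * ∏ b, perp ξ (j b) : ℝ) : ℂ)

/-- The mixed ray transform `L_{k,ℓ} f (x, ξ)`. -/
noncomputable def mixedRay {k ℓ : ℕ} (f : TField k ℓ) (x ξ : Plane) : ℂ :=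
  ∫ t : ℝ, ∑ i : Idx k, ∑ j : Idx ℓ, f i j (x + t • ξ) * mono ξ i j

/-- The unit vector with polar angle `θ`. -/
noncomputable def dir (θ : ℝ) : Plane := !₂[Real.cos θ, Real.sin θ]

/-- The formal `L²` adjoint of the mixed ray transform,
`(L^* g)_{i j}(x) = ∫_{S¹} ξ^i η^j g(x - ⟨x, ξ⟩ ξ, ξ) dS_ξ`, the circle being parametrized by
arc length. Only the values of `g` on `T S¹ = {(x, ξ) : |ξ| = 1, ⟨x, ξ⟩ = 0}` enter. -/
noncomputable def mixedRayAdjoint (k ℓ : ℕ) (g : Plane → Plane → ℂ) : TField k ℓ := fun i j x =>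
  ∫ θ in (0 : ℝ)..(2 * Real.pi),
    mono (dir θ) i j * g (x - (inner ℝ x (dir θ)) • dir θ) (dir θ)

/-- The normal operator `N_{k,ℓ} = L^* L`. -/
noncomputable def normalOp {k ℓ : ℕ} (f : TField k ℓ) : TField k ℓ :=
  mixedRayAdjoint k ℓ (mixedRay f)

/-- The number of indices equal to `2` in a tuple. -/
def numTwos {n : ℕ} (i : Idx n) : ℕ := (Finset.univ.filter fun a => i a = 1).card

/-- The tempered distribution `T` is given by integration against the function `h`. -/
def IsGivenBy (T : 𝓢'(Plane, ℂ)) (h : Plane → ℂ) : Prop :=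
  ∀ φ : 𝓢(Plane, ℂ), MeasureTheory.Integrable (fun x => φ x * h x) ∧ T φ = ∫ x, φ x * h x

/-- `h = m(D) g` for the Fourier multiplier operator with symbol `m`: the functions `g` and `h`
are tempered distributions, the Fourier transform of `g` is a function `G`, and the Fourier
transform of `h` is the function `m G`. (The symbol is a function of the frequency `ξ` in the
convention `∫ e^{-2 π i ⟨x, ξ⟩} g(x) dx`; values of `m` on null sets are irrelevant.) -/
def IsFourierMultiplier (m : Plane → ℂ) (g h : Plane → ℂ) : Prop :=
  ∃ (S T : 𝓢'(Plane, ℂ)) (G : Plane → ℂ), IsGivenBy S g ∧ IsGivenBy T h ∧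
    IsGivenBy (𝓕 S) G ∧ IsGivenBy (𝓕 T) (fun ξ => m ξ * G ξ)

/-- The symbol `y_a = 2 π ξ_a` of `D_{x_a} = (1 / i) ∂_{x_a}`. -/
noncomputable def symD (a : Fin 2) (ξ : Plane) : ℂ := ((2 * Real.pi * ξ a : ℝ) : ℂ)

/-- The symbol `|y| = 2 π |ξ|` of `(-Δ)^{1/2}`. -/
noncomputable def symSqrtLaplacian (ξ : Plane) : ℂ := ((2 * Real.pi * ‖ξ‖ : ℝ) : ℂ)

end MixedRay

/-!
For a vector `ξ` with `ξ^⊥ = (-ξ₂, ξ₁)`, call the form `T(ξ, …, ξ, ξ^⊥, …, ξ^⊥)` of degree `k + ℓ`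
the restriction of a bisymmetric tensor `T`. Three algebraic facts carry the argument. A trace-free
tensor is determined by a sequence of `k + ℓ + 1` numbers (`exists_eq_traceFreeOf`). By duality, a
tensor with zero restriction is in the range of `λ` (`isLam_of_restriction_eq_zero`). And every form
is the restriction of a trace-free tensor (`sum_traceFreeOf_average`).

*Existence.* On the Fourier side, the solenoidal trace-free tensors at the frequency `y` are the
multiples of `ω ⊗ ⋯ ⊗ ω ⊗ ω^⊥ ⊗ ⋯ ⊗ ω^⊥` with `ω = y^⊥ / |y|`, and `f^s` is obtained by orthogonal
projection of the Fourier transform of `f` to this line (`solHat`, `solPart`). The restriction of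
the projection is the restriction of the original tensor with `ξ` replaced by its component along
`ω`. Hence their difference is divisible by `⟨y, ξ⟩`, the symbol of `d'` on restrictions, and the
quotient is the restriction of a trace-free tensor of size `O(|y|⁻¹)`
(`exists_traceFree_quotient`). As `|y|⁻¹` is locally integrable in the plane, this tensor has an
inverse Fourier transform `u`, which is smooth and vanishes at infinity. The remainder
`f - f^s - d' u` has zero restriction, so it is `λ w` (`isSolenoidalPart_solPart`).

*Reconstruction.* By Fubini and the Fourier slice theorem, the Fourier transform of `N f` is an
integral over the lines orthogonal to the rays; in polar coordinates it becomes `2 / |y|` times the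
Fourier transform of `f^s` (`integral_fourier_mul_normalOp`). The components of
`ω ⊗ ⋯ ⊗ ω^⊥` are monomials in `y`, so that their quotients give the symbol
(`symbol_mul_solHat`).

*Uniqueness.* The difference `S` of two solenoidal parts is solenoidal and trace-free, tends to zero
at infinity, and has the form `d' u + λ w`. Put `v = (-∂₂, ∂₁)`. Contraction with
`v ⊗ ⋯ ⊗ v ⊗ v^⊥ ⊗ ⋯ ⊗ v^⊥` annihilates the ranges of `d'` and `λ`, hence `S`; but the divergence
condition makes the components of `S` proportional, over the commutative ring of differential
operators, to those of this product. Together the two give `Δ ^ (k + ℓ) S = 0`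
(`pow_smul_eq_zero_of_contr_eq_zero`, `lap_iterate_eq_zero`). A polyharmonic function that tends to
zero at infinity is zero: its mollifications have iterated Laplacians that tend to zero as well, and
Liouville's theorem for harmonic functions applies to these one after the other
(`eq_zero_of_lap_iterate_eq_zero`).
-/

namespace MixedRay

/-! ### Contractions and trace-free tensors -/

section Algebra

variable {R M : Type*} [CommRing R] [AddCommGroup M] [Module R M] {k ℓ : ℕ}

/-- The product `v_{i₁} ⋯ v_{i_k} v^⊥_{j₁} ⋯ v^⊥_{j_ℓ}` with `v^⊥ = (-v₂, v₁)`, for a pair `v`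
of elements of a commutative ring; it is used for numbers and for differential operators. -/
def monoR (v : Fin 2 → R) (i : Idx k) (j : Idx ℓ) : R :=
  (∏ a, v (i a)) * ∏ b, (![-v 1, v 0] : Fin 2 → R) (j b)

/-- The contraction of a tensor with `v ⊗ ⋯ ⊗ v ⊗ v^⊥ ⊗ ⋯ ⊗ v^⊥`. -/
def contr (v : Fin 2 → R) (T : Idx k → Idx ℓ → M) : M :=
  ∑ i, ∑ j, monoR v i j • T i j

lemma mono_eq_monoR (ξ : Plane) (i : Idx k) (j : Idx ℓ) :
    mono ξ i j = monoR (fun a => (ξ a : ℂ)) i j := by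
  unfold mono monoR perp
  push_cast
  congr 1
  refine Finset.prod_congr rfl fun b _ => ?_
  generalize j b = c
  fin_cases c <;> simp

lemma numTwos_le {n : ℕ} (i : Idx n) : numTwos i ≤ n := by
  simpa [numTwos] using Finset.card_le_univ (Finset.univ.filter fun a => i a = 1)

lemma numTwos_comp_perm {n : ℕ} (i : Idx n) (π : Equiv.Perm (Fin n)) :
    numTwos (i ∘ π) = numTwos i := by
  unfold numTwos
  refine Finset.card_bij (fun a _ => π a) (by simp) (fun _ _ _ _ h => π.injective h) ?_
  intro b hb
  exact ⟨π.symm b, by simpa using hb, by simp⟩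

lemma numTwos_cons {n : ℕ} (c : Fin 2) (i : Idx n) :
    numTwos (Fin.cons c i : Idx (n + 1)) = numTwos i + c.val := by
  unfold numTwos
  rw [Fin.card_filter_univ_succ]
  fin_cases c <;> simp

lemma prod_idx {n : ℕ} (v : Fin 2 → R) (i : Idx n) :
    ∏ a, v (i a) = v 0 ^ (n - numTwos i) * v 1 ^ numTwos i := by
  induction n with
  | zero => simp [numTwos]
  | succ n ih =>
    rw [← Fin.cons_self_tail i, numTwos_cons, Fin.prod_univ_succ]
    simp only [Fin.cons_zero, Fin.cons_succ]
    rw [ih (Fin.tail i)]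
    have h := numTwos_le (Fin.tail i)
    generalize i 0 = c
    fin_cases c
    · simp only [Fin.zero_eta, add_zero]
      rw [Nat.sub_add_comm h]; ring
    · simp only [Fin.mk_one, Nat.add_sub_add_right]
      ring

/-- Up to sign, `monoR v i j` is the monomial whose exponent of `v₂` counts the `2`'s in `i` and the
`1`'s in `j`. -/
lemma monoR_eq (v : Fin 2 → R) (i : Idx k) (j : Idx ℓ) :
    monoR v i j = (-1) ^ (ℓ - numTwos j) *
      (v 0 ^ (k + ℓ - (numTwos i + (ℓ - numTwos j))) * v 1 ^ (numTwos i + (ℓ - numTwos j))) := by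
  unfold monoR
  rw [prod_idx, prod_idx]
  have h1 := numTwos_le i
  have h2 := numTwos_le j
  have h3 : k + ℓ - (numTwos i + (ℓ - numTwos j)) = (k - numTwos i) + numTwos j := by omega
  rw [h3]
  simp only [Matrix.cons_val_zero, Matrix.cons_val_one]
  rw [neg_pow]
  ring

lemma monoR_smul (c : R) (v : Fin 2 → R) (i : Idx k) (j : Idx ℓ) :
    monoR (fun a => c * v a) i j = c ^ (k + ℓ) * monoR v i j := by
  simp only [monoR_eq, mul_pow]
  have h1 := numTwos_le i
  have h2 := numTwos_le j
  have h3 : k + ℓ = (k + ℓ - (numTwos i + (ℓ - numTwos j))) + (numTwos i + (ℓ - numTwos j)) := by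
    omega
  conv_rhs => rw [h3, pow_add]
  simp only [Nat.add_sub_cancel]
  ring

lemma monoR_comp_perm (v : Fin 2 → R) (i : Idx k) (j : Idx ℓ) (π : Equiv.Perm (Fin k))
    (ρ : Equiv.Perm (Fin ℓ)) : monoR v (i ∘ π) (j ∘ ρ) = monoR v i j := by
  simp only [monoR_eq, numTwos_comp_perm]

lemma monoR_cons_left (v : Fin 2 → R) (c : Fin 2) (i : Idx k) (j : Idx ℓ) :
    monoR v (Fin.cons c i : Idx (k + 1)) j = v c * monoR v i j := by
  simp only [monoR, Fin.prod_univ_succ, Fin.cons_zero, Fin.cons_succ]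
  ring

lemma monoR_cons_right (v : Fin 2 → R) (c : Fin 2) (i : Idx k) (j : Idx ℓ) :
    monoR v i (Fin.cons c j : Idx (ℓ + 1)) = (![-v 1, v 0] : Fin 2 → R) c * monoR v i j := by
  simp only [monoR, Fin.prod_univ_succ, Fin.cons_zero, Fin.cons_succ]
  ring

/-- Contracting two such products gives a power of the inner product, as the rotation
`v ↦ v^⊥` preserves it. -/
lemma sum_monoR_mul_monoR (v ξ : Fin 2 → R) :
    ∑ i : Idx k, ∑ j : Idx ℓ, monoR v i j * monoR ξ i j =
      (v 0 * ξ 0 + v 1 * ξ 1) ^ (k + ℓ) := by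
  have h1 (n : ℕ) (a b : Fin 2 → R) : ∑ i : Idx n, (∏ t, a (i t)) * ∏ t, b (i t) =
      (a 0 * b 0 + a 1 * b 1) ^ n := by
    have := (Finset.prod_univ_sum (fun _ : Fin n => (Finset.univ : Finset (Fin 2)))
      (fun _ c => a c * b c)).symm
    simp only [Fintype.piFinset_univ, Finset.prod_mul_distrib, Fin.sum_univ_two,
      Finset.prod_const, Finset.card_univ, Fintype.card_fin] at this
    exact this
  have h2 : ∀ (i : Idx k) (j : Idx ℓ), monoR v i j * monoR ξ i j =
      ((∏ t, v (i t)) * ∏ t, ξ (i t)) * ((∏ t, (![-v 1, v 0] : Fin 2 → R) (j t)) *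
        ∏ t, (![-ξ 1, ξ 0] : Fin 2 → R) (j t)) := by
    intro i j; unfold monoR; ring
  simp only [h2]
  rw [← Finset.sum_mul_sum, h1, h1, pow_add]
  congr 2
  simp; ring

lemma sum_idx_succ {N : Type*} [AddCommMonoid N] {n : ℕ} (F : Idx (n + 1) → N) :
    ∑ i, F i = ∑ c : Fin 2, ∑ i : Idx n, F (Fin.cons c i) := by
  rw [← (Fin.consEquiv fun _ : Fin (n + 1) => Fin 2).sum_comp, Fintype.sum_prod_type]
  rfl

lemma sum_idx_comp_perm {N : Type*} [AddCommMonoid N] {n : ℕ} (π : Equiv.Perm (Fin n))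
    (F : Idx n → N) : ∑ i : Idx n, F (i ∘ π) = ∑ i, F i :=
  (Equiv.arrowCongr π.symm (Equiv.refl (Fin 2))).sum_comp F

/-- Pairing with a symmetric array does not see symmetrization. -/
lemma sum_smul_symmetrize_left {c : Idx k → Idx ℓ → R}
    (hc : ∀ (π : Equiv.Perm (Fin k)) i j, c (i ∘ π) j = c i j) (T : Idx k → Idx ℓ → M) :
    ∑ i, ∑ j, c i j • ∑ π : Equiv.Perm (Fin k), T (i ∘ π) j =
      (k.factorial : R) • ∑ i, ∑ j, c i j • T i j := by
  simp only [Finset.smul_sum]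
  rw [Finset.sum_congr rfl fun i _ => Finset.sum_comm, Finset.sum_comm]
  have : ∀ π : Equiv.Perm (Fin k), ∑ i, ∑ j, c i j • T (i ∘ π) j = ∑ i, ∑ j, c i j • T i j := by
    intro π
    rw [← sum_idx_comp_perm π (fun i => ∑ j, c i j • T i j)]
    simp only [hc]
  simp only [this, Finset.sum_const, Finset.card_univ, Fintype.card_perm, Fintype.card_fin]
  rw [← Nat.cast_smul_eq_nsmul R]
  simp only [Finset.smul_sum]

lemma sum_smul_symmetrize_right {c : Idx k → Idx ℓ → R}
    (hc : ∀ (π : Equiv.Perm (Fin ℓ)) i j, c i (j ∘ π) = c i j) (T : Idx k → Idx ℓ → M) :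
    ∑ i, ∑ j, c i j • ∑ π : Equiv.Perm (Fin ℓ), T i (j ∘ π) =
      (ℓ.factorial : R) • ∑ i, ∑ j, c i j • T i j := by
  have := sum_smul_symmetrize_left (M := M) (c := fun j i => c i j) (fun π j i => hc π i j)
    (fun j i => T i j)
  rw [Finset.sum_comm, this, Finset.sum_comm]

/-- The pairing of a symmetric array with the (unnormalized) tensor `λ w` is the pairing of its
trace with `w`. -/
lemma sum_smul_lam {c : Idx (k + 1) → Idx (ℓ + 1) → R}
    (hc : ∀ (π : Equiv.Perm (Fin (k + 1))) i j, c (i ∘ π) j = c i j)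
    (hc' : ∀ (π : Equiv.Perm (Fin (ℓ + 1))) i j, c i (j ∘ π) = c i j) (w : Idx k → Idx ℓ → M) :
    ∑ i, ∑ j, c i j • (∑ π : Equiv.Perm (Fin (k + 1)), ∑ ρ : Equiv.Perm (Fin (ℓ + 1)),
      if i (π 0) = j (ρ 0) then w (fun a => i (π a.succ)) (fun b => j (ρ b.succ)) else 0) =
    (((k + 1).factorial : R) * ((ℓ + 1).factorial : R)) •
      ∑ i, ∑ j, (∑ a, c (Fin.cons a i) (Fin.cons a j)) • w i j := by
  have h1 := sum_smul_symmetrize_left hc (fun i j => ∑ ρ : Equiv.Perm (Fin (ℓ + 1)),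
      if i 0 = j (ρ 0) then w (fun a => i a.succ) (fun b => j (ρ b.succ)) else 0)
  have h2 := sum_smul_symmetrize_right hc' (fun i j =>
      if i 0 = j 0 then w (fun a => i a.succ) (fun b => j b.succ) else 0)
  simp only [Function.comp_apply] at h1 h2
  rw [h1, h2, smul_smul]
  congr 1
  rw [sum_idx_succ]
  simp only [sum_idx_succ (n := ℓ)]
  simp only [Fin.cons_zero, Fin.cons_succ, Fin.sum_univ_two]
  simp [Finset.sum_add_distrib, add_smul]

/-- The (unnormalized) tensors `λ w` restrict to zero, because `⟨v, v^⊥⟩ = 0`. -/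
lemma contr_lam (v : Fin 2 → R) (w : Idx k → Idx ℓ → M) :
    contr v (fun (i : Idx (k + 1)) (j : Idx (ℓ + 1)) =>
      ∑ π : Equiv.Perm (Fin (k + 1)), ∑ ρ : Equiv.Perm (Fin (ℓ + 1)),
      if i (π 0) = j (ρ 0) then w (fun a => i (π a.succ)) (fun b => j (ρ b.succ)) else 0) = 0 := by
  unfold contr
  rw [sum_smul_lam (fun π i j => monoR_comp_perm v i j π 1)
    (fun π i j => monoR_comp_perm v i j 1 π)]
  simp [monoR_cons_left, monoR_cons_right, ← mul_assoc, mul_comm]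

/-- Contracting the symmetrization of `T_c` over `c` and the first group of indices is
contracting `T_c` and then pairing `c` with `v`. -/
lemma contr_symmetrize (v : Fin 2 → R) (T : Fin 2 → Idx k → Idx ℓ → M) :
    contr v (fun (i : Idx (k + 1)) (j : Idx ℓ) =>
      ∑ π : Equiv.Perm (Fin (k + 1)), T (i (π 0)) (fun a => i (π a.succ)) j) =
    ((k + 1).factorial : R) • ∑ c, v c • contr v (T c) := by
  have h := sum_smul_symmetrize_left (c := monoR v (k := k + 1) (ℓ := ℓ))
    (fun π i j => monoR_comp_perm v i j π 1) (fun i j => T (i 0) (fun a => i a.succ) j)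
  simp only [Function.comp_apply] at h
  unfold contr
  rw [h, sum_idx_succ]
  simp only [Fin.cons_zero, Fin.cons_succ, monoR_cons_left, Finset.smul_sum, mul_smul]

/-- The trace-free bisymmetric tensor determined by a sequence `s`: its components are, up to
sign, `s p` where `p` counts the `2`'s in the first group and the `1`'s in the second. -/
def traceFreeOf (s : ℕ → M) (i : Idx k) (j : Idx ℓ) : M :=
  ((-1 : ℤ) ^ (ℓ - numTwos j)) • s (numTwos i + (ℓ - numTwos j))

lemma traceFreeOf_trace (s : ℕ → M) (i : Idx k) (j : Idx ℓ) :
    ∑ a : Fin 2, traceFreeOf s (Fin.cons a i : Idx (k + 1)) (Fin.cons a j : Idx (ℓ + 1)) = 0 := by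
  have h := numTwos_le j
  simp only [Fin.sum_univ_two, traceFreeOf, numTwos_cons, Fin.val_zero, Fin.val_one]
  rw [show ℓ + 1 - (numTwos j + 0) = (ℓ - numTwos j) + 1 by omega,
    show ℓ + 1 - (numTwos j + 1) = ℓ - numTwos j by omega,
    show numTwos i + 1 + (ℓ - numTwos j) = numTwos i + 0 + (ℓ - numTwos j + 1) by omega, pow_succ]
  simp

lemma exists_perm_of_numTwos_eq {n : ℕ} {i i' : Idx n} (h : numTwos i = numTwos i') :
    ∃ π : Equiv.Perm (Fin n), i' ∘ π = i := by
  have hc : Fintype.card {a // i a = 1} = Fintype.card {a // i' a = 1} := by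
    simpa [Fintype.card_subtype, numTwos] using h
  let e := Fintype.equivOfCardEq hc
  refine ⟨e.extendSubtype, funext fun a => ?_⟩
  by_cases ha : i a = 1
  · simpa [ha] using e.extendSubtype_mem a ha
  · have := e.extendSubtype_not_mem a ha
    simp only [Function.comp_apply]
    omega

/-- The tuple `(2, …, 2, 1, …, 1)` with `N` twos. -/
def stdIdx (n N : ℕ) : Idx n := fun a => if a.val < N then 1 else 0

lemma numTwos_stdIdx {n N : ℕ} (h : N ≤ n) : numTwos (stdIdx n N) = N := by
  have : (Finset.univ.filter fun a : Fin n => stdIdx n N a = 1) =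
      Finset.univ.filter fun a : Fin n => a.val < N := by
    ext a; simp [stdIdx]
  rw [numTwos, this, Fin.card_filter_val_lt]
  omega

/-- A trace-free bisymmetric tensor is determined by one sequence: the trace condition relates the
components with `(M, N)` and `(M + 1, N + 1)` twos. -/
lemma exists_eq_traceFreeOf (c : Idx k → Idx ℓ → M)
    (hc : ∀ (π : Equiv.Perm (Fin k)) i j, c (i ∘ π) j = c i j)
    (hc' : ∀ (π : Equiv.Perm (Fin ℓ)) i j, c i (j ∘ π) = c i j)
    (ht : ∀ (k' ℓ' : ℕ) (hk : k' + 1 = k) (hl : ℓ' + 1 = ℓ) (i : Idx k') (j : Idx ℓ'),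
      ∑ a : Fin 2, c ((Fin.cons a i : Idx (k' + 1)) ∘ Fin.cast hk.symm)
        ((Fin.cons a j : Idx (ℓ' + 1)) ∘ Fin.cast hl.symm) = 0) :
    ∃ s : ℕ → M, c = traceFreeOf s := by
  -- by symmetry a component depends only on the numbers of twos in the two groups
  let γ : ℕ → ℕ → M := fun m n => c (stdIdx k m) (stdIdx ℓ n)
  have hγ : ∀ i j, c i j = γ (numTwos i) (numTwos j) := by
    intro i j
    obtain ⟨π, hπ⟩ := exists_perm_of_numTwos_eq (i := i) (i' := stdIdx k (numTwos i))
      (numTwos_stdIdx (numTwos_le i)).symm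
    obtain ⟨ρ, hρ⟩ := exists_perm_of_numTwos_eq (i := j) (i' := stdIdx ℓ (numTwos j))
      (numTwos_stdIdx (numTwos_le j)).symm
    rw [← hπ, ← hρ, hc, hc', hπ, hρ]
  have hstep : ∀ m n, m < k → n < ℓ → γ (m + 1) (n + 1) = -γ m n := by
    intro m n hm hn
    obtain ⟨k', rfl⟩ : ∃ k', k = k' + 1 := ⟨k - 1, by omega⟩
    obtain ⟨ℓ', rfl⟩ : ∃ ℓ', ℓ = ℓ' + 1 := ⟨ℓ - 1, by omega⟩
    have h := ht k' ℓ' rfl rfl (stdIdx k' m) (stdIdx ℓ' n)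
    simp only [Fin.sum_univ_two, Fin.cast_refl, Function.comp_id] at h
    rw [hγ, hγ (Fin.cons 1 _)] at h
    simp only [numTwos_cons, numTwos_stdIdx (Nat.lt_succ_iff.mp hm),
      numTwos_stdIdx (Nat.lt_succ_iff.mp hn), Fin.val_zero, Fin.val_one, add_zero] at h
    exact eq_neg_of_add_eq_zero_right h
  have hd : ∀ d m n, m + d ≤ k → n + d ≤ ℓ → γ (m + d) (n + d) = ((-1 : ℤ) ^ d) • γ m n := by
    intro d
    induction d with
    | zero => simp
    | succ d ih =>
      intro m n h1 h2
      rw [← add_assoc, ← add_assoc, hstep _ _ (by omega) (by omega), ih _ _ (by omega) (by omega),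
        pow_succ]
      simp
  -- along a diagonal `m - n = p - ℓ` the value is normalized at its end point `m = 0` or `n = 0`
  refine ⟨fun p => ((-1 : ℤ) ^ min p ℓ) • γ (p - ℓ) (ℓ - p), ?_⟩
  funext i j
  have h1 := numTwos_le i
  have h2 := numTwos_le j
  rw [hγ, traceFreeOf, smul_smul, ← pow_add]
  generalize numTwos i = m at *
  generalize numTwos j = n at *
  rcases le_total m n with h | h
  · rw [show m + (ℓ - n) - ℓ = 0 by omega, show ℓ - (m + (ℓ - n)) = n - m by omega,
      show ℓ - n + min (m + (ℓ - n)) ℓ = 2 * (ℓ - n) + m by omega, pow_add, pow_mul]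
    have := hd m 0 (n - m) (by omega) (by omega)
    rw [zero_add, Nat.sub_add_cancel h] at this
    simpa using this
  · rw [show m + (ℓ - n) - ℓ = m - n by omega, show ℓ - (m + (ℓ - n)) = 0 by omega,
      show ℓ - n + min (m + (ℓ - n)) ℓ = 2 * (ℓ - n) + n by omega, pow_add, pow_mul]
    have := hd n (m - n) 0 (by omega) (by omega)
    rw [zero_add, Nat.sub_add_cancel h] at this
    simpa using this

end Algebra

/-- A trace-free bisymmetric tensor annihilates every tensor whose restriction to
`(ξ, …, ξ, ξ^⊥, …, ξ^⊥)` vanishes identically. -/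
lemma sum_traceFreeOf_mul_eq_zero {k ℓ : ℕ} (s : ℕ → ℂ) (r : Idx k → Idx ℓ → ℂ)
    (hr : ∀ ξ : Plane, ∑ i, ∑ j, r i j * mono ξ i j = 0) :
    ∑ i, ∑ j, traceFreeOf s i j * r i j = 0 := by
  -- the restriction of `r` to `ξ = (1, t)`, as a polynomial in `t`; it vanishes at all real `t`
  let P : Polynomial ℂ := ∑ i, ∑ j,
    Polynomial.monomial (numTwos i + (ℓ - numTwos j)) ((-1) ^ (ℓ - numTwos j) * r i j)
  have hP : P = 0 := by
    refine Polynomial.eq_zero_of_infinite_isRoot _ ?_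
    refine Set.Infinite.mono (s := Set.range ((↑) : ℝ → ℂ)) ?_
      (Set.infinite_range_of_injective Complex.ofReal_injective)
    rintro _ ⟨t, rfl⟩
    have := hr (!₂[1, t])
    simp only [mono_eq_monoR, monoR_eq] at this
    simp only [Set.mem_ofPred_eq, Polynomial.IsRoot, P, Polynomial.eval_finsetSum,
      Polynomial.eval_monomial]
    rw [← this]
    refine Finset.sum_congr rfl fun i _ => Finset.sum_congr rfl fun j _ => ?_
    simp
    ring
  -- the functional that sends `X ^ p` to `s p` turns the coefficients of `P` into the pairing
  have hL := congrArg (Polynomial.lsum (R := ℂ) fun n => LinearMap.lsmul ℂ ℂ |>.flip (s n)) hP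
  simp only [P, map_sum, Polynomial.lsum_apply, map_zero] at hL
  rw [← hL]
  refine Finset.sum_congr rfl fun i _ => Finset.sum_congr rfl fun j _ => ?_
  rw [Polynomial.sum_monomial_index _ _ (by simp)]
  simp [traceFreeOf]
  ring

end MixedRay

namespace MixedRay

/-! ### The range of `λ` -/

section LamKernel

variable {k ℓ : ℕ}

/-- The operator `λ` at a point, as a linear map. -/
noncomputable def lamLin (k ℓ : ℕ) :
    (Idx k → Idx ℓ → ℂ) →ₗ[ℂ] (Idx (k + 1) → Idx (ℓ + 1) → ℂ) where
  toFun w i j := (1 / ((k + 1).factorial : ℂ)) * (1 / ((ℓ + 1).factorial : ℂ)) *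
    ∑ π : Equiv.Perm (Fin (k + 1)), ∑ ρ : Equiv.Perm (Fin (ℓ + 1)),
      if i (π 0) = j (ρ 0) then w (fun a => i (π a.succ)) (fun b => j (ρ b.succ)) else 0
  map_add' w w' := by
    funext i j
    simp only [Pi.add_apply, ← mul_add, ← Finset.sum_add_distrib]
    congr 1
    refine Finset.sum_congr rfl fun π _ => Finset.sum_congr rfl fun ρ _ => ?_
    split_ifs <;> simp
  map_smul' c w := by
    funext i j
    simp only [Pi.smul_apply, smul_eq_mul, RingHom.id_apply, Finset.mul_sum, mul_ite, mul_zero]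
    refine Finset.sum_congr rfl fun π _ => Finset.sum_congr rfl fun ρ _ => ?_
    split_ifs
    · ring
    · rfl

lemma lam_apply (w : TField k ℓ) (i : Idx (k + 1)) (j : Idx (ℓ + 1)) (x : Plane) :
    lam w i j x = lamLin k ℓ (fun i j => w i j x) i j := rfl

/-- The bisymmetric tensors. -/
def symTensors (k ℓ : ℕ) : Submodule ℂ (Idx k → Idx ℓ → ℂ) where
  carrier := {c | (∀ (π : Equiv.Perm (Fin k)) i j, c (i ∘ π) j = c i j) ∧
    ∀ (π : Equiv.Perm (Fin ℓ)) i j, c i (j ∘ π) = c i j}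
  add_mem' ha hb := ⟨fun π i j => by simp [ha.1, hb.1], fun π i j => by simp [ha.2, hb.2]⟩
  zero_mem' := ⟨fun _ _ _ => rfl, fun _ _ _ => rfl⟩
  smul_mem' c _ ha := ⟨fun π i j => by simp [ha.1], fun π i j => by simp [ha.2]⟩

/-- On bisymmetric tensors, the transpose of `λ` is the trace. -/
lemma sum_mul_lamLin {c : Idx (k + 1) → Idx (ℓ + 1) → ℂ} (hc : c ∈ symTensors (k + 1) (ℓ + 1))
    (w : Idx k → Idx ℓ → ℂ) :
    ∑ i, ∑ j, c i j * lamLin k ℓ w i j =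
      ∑ i, ∑ j, (∑ a, c (Fin.cons a i) (Fin.cons a j)) * w i j := by
  have h := sum_smul_lam hc.1 hc.2 w
  simp only [smul_eq_mul] at h
  have h1 : ((k + 1).factorial : ℂ) ≠ 0 := by exact_mod_cast (Nat.factorial_pos _).ne'
  have h2 : ((ℓ + 1).factorial : ℂ) ≠ 0 := by exact_mod_cast (Nat.factorial_pos _).ne'
  rw [← mul_right_inj' (mul_ne_zero h1 h2), ← h, Finset.mul_sum]
  refine Finset.sum_congr rfl fun i _ => ?_
  rw [Finset.mul_sum]
  refine Finset.sum_congr rfl fun j _ => ?_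
  simp only [lamLin, LinearMap.coe_mk, AddHom.coe_mk]
  field_simp

/-- The symmetrization (without normalization) over both groups of indices. -/
def symmetrize (c : Idx k → Idx ℓ → ℂ) (i : Idx k) (j : Idx ℓ) : ℂ :=
  ∑ π : Equiv.Perm (Fin k), ∑ ρ : Equiv.Perm (Fin ℓ), c (i ∘ π) (j ∘ ρ)

lemma symmetrize_mem (c : Idx k → Idx ℓ → ℂ) : symmetrize c ∈ symTensors k ℓ := by
  refine ⟨fun σ i j => ?_, fun σ i j => ?_⟩
  · unfold symmetrize
    rw [← Equiv.sum_comp (Equiv.mulLeft σ)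
      (fun π : Equiv.Perm (Fin k) => ∑ ρ : Equiv.Perm (Fin ℓ), c (i ∘ π) (j ∘ ρ))]
    rfl
  · unfold symmetrize
    refine Finset.sum_congr rfl fun π _ => ?_
    rw [← Equiv.sum_comp (Equiv.mulLeft σ) (fun ρ : Equiv.Perm (Fin ℓ) => c (i ∘ π) (j ∘ ρ))]
    rfl

lemma sum_symmetrize_mul (c : Idx k → Idx ℓ → ℂ) {r : Idx k → Idx ℓ → ℂ}
    (hr : r ∈ symTensors k ℓ) :
    ∑ i, ∑ j, symmetrize c i j * r i j =
      ((k.factorial : ℂ) * (ℓ.factorial : ℂ)) * ∑ i, ∑ j, c i j * r i j := by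
  have h1 := sum_smul_symmetrize_left hr.1
    (fun i j => ∑ ρ : Equiv.Perm (Fin ℓ), c i (j ∘ ρ))
  have h2 := sum_smul_symmetrize_right hr.2 c
  simp only [smul_eq_mul] at h1 h2
  simp only [symmetrize, mul_comm _ (r _ _)]
  rw [h1, h2, mul_assoc]

lemma exists_eq_traceFreeOf_of_mem {c : Idx k → Idx ℓ → ℂ} (hc : c ∈ symTensors k ℓ)
    (ht : ∀ (k' ℓ' : ℕ) (hk : k' + 1 = k) (hl : ℓ' + 1 = ℓ) (i : Idx k') (j : Idx ℓ'),
      ∑ a : Fin 2, c ((Fin.cons a i : Idx (k' + 1)) ∘ Fin.cast hk.symm)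
        ((Fin.cons a j : Idx (ℓ' + 1)) ∘ Fin.cast hl.symm) = 0) :
    ∃ s : ℕ → ℂ, c = traceFreeOf s := exists_eq_traceFreeOf c hc.1 hc.2 ht

lemma conj_mem_symTensors {c : Idx k → Idx ℓ → ℂ} (hc : c ∈ symTensors k ℓ) :
    (fun i j => (starRingEnd ℂ) (c i j)) ∈ symTensors k ℓ :=
  ⟨fun π i j => by simp only [hc.1], fun π i j => by simp only [hc.2]⟩

lemma eq_zero_of_sum_conj_mul {c : Idx k → Idx ℓ → ℂ}
    (h : ∑ i, ∑ j, c i j * (starRingEnd ℂ) (c i j) = 0) (i : Idx k) (j : Idx ℓ) : c i j = 0 := by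
  simp only [Complex.mul_conj] at h
  have h' : ∑ i, ∑ j, Complex.normSq (c i j) = 0 := by exact_mod_cast h
  rw [Finset.sum_eq_zero_iff_of_nonneg
    (fun i _ => Finset.sum_nonneg fun j _ => Complex.normSq_nonneg _)] at h'
  have h2 := h' i (Finset.mem_univ _)
  rw [Finset.sum_eq_zero_iff_of_nonneg (fun j _ => Complex.normSq_nonneg _)] at h2
  exact Complex.normSq_eq_zero.mp (h2 j (Finset.mem_univ _))

/-- With an empty second group, a symmetric tensor with vanishing restriction is zero. -/
lemma eq_zero_of_restriction_eq_zero {r : Idx k → Idx 0 → ℂ} (hr : r ∈ symTensors k 0)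
    (h0 : ∀ ξ : Plane, ∑ i, ∑ j, r i j * mono ξ i j = 0) : r = 0 := by
  -- without a second group every symmetric tensor is trace-free, so `r` can be tested against its
  -- own conjugate
  obtain ⟨s, hs⟩ := exists_eq_traceFreeOf_of_mem (conj_mem_symTensors hr)
    (fun _ _ _ hl => absurd hl (Nat.succ_ne_zero _))
  funext i j
  refine eq_zero_of_sum_conj_mul ?_ i j
  have := sum_traceFreeOf_mul_eq_zero s r h0
  rw [← hs] at this
  simpa only [mul_comm] using this

lemma cons_comp_perm_decomp {n : ℕ} (a : Fin 2) (i : Idx n) (π : Equiv.Perm (Fin n)) :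
    (Fin.cons a (i ∘ π) : Idx (n + 1)) =
      (Fin.cons a i : Idx (n + 1)) ∘ (Equiv.Perm.decomposeFin.symm (0, π)) := by
  funext t
  refine Fin.cases ?_ (fun t => ?_) t <;> simp

/-- A bisymmetric tensor whose restriction to `(ξ, …, ξ, ξ^⊥, …, ξ^⊥)` vanishes identically is in
the range of `λ`. The range of `λ` is described by duality: a functional that vanishes on it is
given, on bisymmetric tensors, by a trace-free one. -/
lemma mem_map_lamLin {r : Idx (k + 1) → Idx (ℓ + 1) → ℂ} (hr : r ∈ symTensors (k + 1) (ℓ + 1))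
    (h0 : ∀ ξ : Plane, ∑ i, ∑ j, r i j * mono ξ i j = 0) :
    r ∈ (symTensors k ℓ).map (lamLin k ℓ) := by
  by_contra hmem
  obtain ⟨φ, hφ, hle⟩ := Submodule.exists_le_ker_of_notMem hmem
  -- the coefficients of `φ`; their symmetrization represents `φ` on bisymmetric tensors up to a
  -- positive factor
  let c : Idx (k + 1) → Idx (ℓ + 1) → ℂ := fun i j => φ (Pi.single i (Pi.single j 1))
  have hφc : ∀ v : Idx (k + 1) → Idx (ℓ + 1) → ℂ, φ v = ∑ i, ∑ j, c i j * v i j := by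
    intro v
    have hv : v = ∑ i, ∑ j, v i j • (Pi.single i (Pi.single j (1 : ℂ)) :
        Idx (k + 1) → Idx (ℓ + 1) → ℂ) := by
      funext i j
      simp [Finset.sum_apply, Pi.single_apply, ite_apply]
    conv_lhs => rw [hv]
    simp only [map_sum, map_smul, smul_eq_mul, c, mul_comm]
  have hlamsym : ∀ w ∈ symTensors k ℓ, ∑ i, ∑ j,
      (∑ a, symmetrize c (Fin.cons a i) (Fin.cons a j)) * w i j = 0 := by
    intro w hw
    have hmem : lamLin k ℓ w ∈ symTensors (k + 1) (ℓ + 1) := by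
      refine ⟨fun σ i j => ?_, fun σ i j => ?_⟩
      · simp only [lamLin, LinearMap.coe_mk, AddHom.coe_mk]
        congr 1
        exact Equiv.sum_comp (Equiv.mulLeft σ) (fun π : Equiv.Perm (Fin (k + 1)) =>
          ∑ ρ : Equiv.Perm (Fin (ℓ + 1)), if i (π 0) = j (ρ 0) then
            w (fun a => i (π a.succ)) (fun b => j (ρ b.succ)) else 0)
      · simp only [lamLin, LinearMap.coe_mk, AddHom.coe_mk]
        congr 1
        refine Finset.sum_congr rfl fun π _ => ?_
        exact Equiv.sum_comp (Equiv.mulLeft σ) (fun ρ : Equiv.Perm (Fin (ℓ + 1)) =>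
          if i (π 0) = j (ρ 0) then
            w (fun a => i (π a.succ)) (fun b => j (ρ b.succ)) else 0)
    rw [← sum_mul_lamLin (symmetrize_mem c), sum_symmetrize_mul c hmem, ← hφc,
      LinearMap.mem_ker.mp (hle (Submodule.mem_map_of_mem hw)), mul_zero]
  have htr : (fun (i : Idx k) (j : Idx ℓ) => ∑ a : Fin 2,
      symmetrize c (Fin.cons a i) (Fin.cons a j)) ∈ symTensors k ℓ := by
    have hs := symmetrize_mem c
    refine ⟨fun π i j => ?_, fun π i j => ?_⟩
    · simp only [cons_comp_perm_decomp, hs.1]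
    · simp only [cons_comp_perm_decomp, hs.2]
  have htr0 := eq_zero_of_sum_conj_mul (hlamsym _ (conj_mem_symTensors htr))
  obtain ⟨s, hs⟩ := exists_eq_traceFreeOf_of_mem (symmetrize_mem c) (by
    rintro k' ℓ' hk hl i j
    obtain rfl : k' = k := by omega
    obtain rfl : ℓ' = ℓ := by omega
    exact htr0 i j)
  have h1 := sum_traceFreeOf_mul_eq_zero s r h0
  rw [← hs, sum_symmetrize_mul c hr, ← hφc] at h1
  have h2 : ((k + 1).factorial : ℂ) ≠ 0 := by exact_mod_cast (Nat.factorial_pos _).ne'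
  have h3 : ((ℓ + 1).factorial : ℂ) ≠ 0 := by exact_mod_cast (Nat.factorial_pos _).ne'
  exact hφ ((mul_eq_zero.mp h1).resolve_left (mul_ne_zero h2 h3))

/-- A smooth bisymmetric field whose restriction to `(ξ, …, ξ, ξ^⊥, …, ξ^⊥)` vanishes is `λ w`
with smooth `w`. -/
lemma isLam_of_restriction_eq_zero {r : TField (k + 1) ℓ} (hr : IsSmoothSym r)
    (h0 : ∀ x ξ : Plane, ∑ i, ∑ j, r i j x * mono ξ i j = 0) : IsLam r := by
  have hmem : ∀ x, (fun i j => r i j x) ∈ symTensors (k + 1) ℓ := fun x =>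
    ⟨fun π i j => congrFun (hr.symm_left π i j) x, fun π i j => congrFun (hr.symm_right π i j) x⟩
  cases ℓ with
  | zero =>
    funext i j x
    exact congrFun (congrFun (eq_zero_of_restriction_eq_zero (hmem x) (h0 x)) i) j
  | succ ℓ =>
    -- a linear right inverse `e` of `λ` on its range makes the choice of `w` smooth in `x`
    let g := (lamLin k ℓ).domRestrict (symTensors k ℓ)
    obtain ⟨h, hh⟩ := g.rangeRestrict.exists_rightInverse_of_surjective
      (LinearMap.range_rangeRestrict g)
    obtain ⟨e, he⟩ := LinearMap.exists_extend h
    have hg : ∀ x, (fun i j => r i j x) ∈ LinearMap.range g := by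
      intro x
      obtain ⟨w, hw, hwr⟩ := mem_map_lamLin (hmem x) (h0 x)
      exact ⟨⟨w, hw⟩, hwr⟩
    refine ⟨fun i j x => (e (fun i j => r i j x)).1 i j, ⟨fun i j => ?_, fun π i j => ?_,
      fun π i j => ?_⟩, ?_⟩
    · have hr' : ContDiff ℝ ∞ (fun x => fun i j => r i j x) :=
        contDiff_pi.mpr fun i => contDiff_pi.mpr fun j => hr.smooth i j
      let L : (Idx (k + 1) → Idx (ℓ + 1) → ℂ) →ₗ[ℝ] ℂ :=
        ((LinearMap.proj j ∘ₗ LinearMap.proj i) ∘ₗ (symTensors k ℓ).subtype ∘ₗ e).restrictScalars ℝ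
      exact (LinearMap.toContinuousLinearMap L).contDiff.comp hr'
    · funext x
      exact (e (fun i j => r i j x)).2.1 π i j
    · funext x
      exact (e (fun i j => r i j x)).2.2 π i j
    · funext i j x
      rw [lam_apply]
      have h1 := congrArg Subtype.val (LinearMap.congr_fun hh ⟨_, hg x⟩)
      have h2 : e (fun i j => r i j x) = h ⟨_, hg x⟩ := LinearMap.congr_fun he ⟨_, hg x⟩
      simp only [h2]
      exact (congrFun (congrFun h1 i) j).symm

end LamKernel

/-! ### Division by `⟨y, ξ⟩` -/

section Division

/-- The division step: a monomial of degree `n + 1` in `ξ` minus its value at the projection of `ξ`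
to the line orthogonal to `y` is divisible by `⟨y, ξ⟩`, with a quotient whose coefficients are
`O(|y|⁻¹)`. -/
lemma exists_quotient (n : ℕ) (i : Idx (n + 1)) :
    ∃ B : Idx n → Plane → ℝ, (∀ q, Measurable (B q)) ∧
      (∃ c : ℝ, ∀ q y, |B q y| ≤ c * ‖y‖⁻¹) ∧
      ∀ y : Plane, y ≠ 0 → ∀ ξ : Plane,
        ∏ a, ξ (i a) - ∏ a, ((-y 1 * ξ 0 + y 0 * ξ 1) / ‖y‖ ^ 2 * perp y (i a)) =
          (y 0 * ξ 0 + y 1 * ξ 1) * ∑ q, B q y * ∏ b, ξ (q b) := by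
  have hcoord : ∀ (y : Plane) (c : Fin 2), |y c| ≤ ‖y‖ := fun y c => by
    simpa using PiLp.norm_apply_le y c
  have hperp : ∀ (y : Plane) (c : Fin 2), |perp y c| ≤ ‖y‖ := fun y c => by
    fin_cases c
    · simpa [perp] using hcoord y 1
    · simpa [perp] using hcoord y 0
  have hdiv : ∀ (y : Plane) (c : Fin 2), |y c / ‖y‖ ^ 2| ≤ ‖y‖⁻¹ := fun y c => by
    rcases eq_or_ne y 0 with rfl | hy
    · simp
    have : 0 < ‖y‖ := norm_pos_iff.mpr hy
    rw [abs_div, abs_of_pos (by positivity : 0 < ‖y‖ ^ 2), div_le_iff₀ (by positivity)]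
    calc |y c| ≤ ‖y‖ := hcoord y c
      _ = ‖y‖⁻¹ * ‖y‖ ^ 2 := by field_simp
  have hproj : ∀ (y : Plane), y ≠ 0 → ∀ (ξ : Plane) (c : Fin 2),
      ξ c - (-y 1 * ξ 0 + y 0 * ξ 1) / ‖y‖ ^ 2 * perp y c =
        (y 0 * ξ 0 + y 1 * ξ 1) * (y c / ‖y‖ ^ 2) := by
    intro y hy ξ c
    have h0 : ‖y‖ ^ 2 ≠ 0 := by simpa using hy
    have h1 : ‖y‖ ^ 2 = y 0 ^ 2 + y 1 ^ 2 := by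
      rw [EuclideanSpace.real_norm_sq_eq, Fin.sum_univ_two]
    field_simp
    rw [h1]
    fin_cases c <;> simp [perp] <;> ring
  have hmeas : ∀ c : Fin 2, Measurable fun y : Plane => y c := fun c => by fun_prop
  have hmeasp : ∀ c : Fin 2, Measurable fun y : Plane => perp y c := fun c => by
    fin_cases c
    · exact (hmeas 1).neg
    · exact hmeas 0
  have hmeasd : ∀ c : Fin 2, Measurable fun y : Plane => y c / ‖y‖ ^ 2 := fun c => by
    have := hmeas c
    fun_prop
  induction n with
  | zero =>
    refine ⟨fun _ y => y (i 0) / ‖y‖ ^ 2, fun _ => hmeasd _, ⟨1, fun _ y => ?_⟩,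
      fun y hy ξ => ?_⟩
    · simpa using hdiv y (i 0)
    · simpa using hproj y hy ξ (i 0)
  | succ n ih =>
    obtain ⟨B, hB1, ⟨c, hc⟩, hB3⟩ := ih (Fin.tail i)
    -- the entries of the orthogonal projection to the line spanned by `perp y`
    let m : Fin 2 → Fin 2 → Plane → ℝ := fun a b y => perp y a * perp y b / ‖y‖ ^ 2
    have hm : ∀ a b y, |m a b y| ≤ 1 := by
      intro a b y
      simp only [m]
      rw [abs_div, abs_mul, abs_of_nonneg (by positivity : 0 ≤ ‖y‖ ^ 2)]
      refine div_le_one_of_le₀ ?_ (by positivity)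
      rw [sq]
      exact mul_le_mul (hperp y a) (hperp y b) (abs_nonneg _) (norm_nonneg _)
    -- `ξ_{i₀} P - p_{i₀} Q = ξ_{i₀} (P - Q) + (ξ_{i₀} - p_{i₀}) Q`, where `p` is the projection
    -- of `ξ`, and `P`, `Q` are the products of the remaining factors
    refine ⟨fun q y => (if q 0 = i 0 then B (Fin.tail q) y else 0) +
      y (i 0) / ‖y‖ ^ 2 * ∏ a, m (Fin.tail i a) (q a) y, fun q => ?_, ⟨|c| + 1, fun q y => ?_⟩,
      fun y hy ξ => ?_⟩
    · refine Measurable.add ?_ ((hmeasd _).mul ?_)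
      · split_ifs
        · exact hB1 _
        · exact measurable_const
      · exact Finset.measurable_fun_prod _ fun a _ =>
          ((hmeasp _).mul (hmeasp _)).div ((measurable_norm).pow_const 2)
    · refine (abs_add_le _ _).trans ?_
      rw [add_mul]
      refine add_le_add ?_ ?_
      · split_ifs
        · refine (hc _ y).trans ?_
          gcongr
          exact le_abs_self c
        · simp; positivity
      · rw [abs_mul, Finset.abs_prod, mul_comm, mul_comm (1 : ℝ), mul_one]
        calc _ ≤ 1 * ‖y‖⁻¹ := by
              gcongr
              · exact Finset.prod_le_one (fun _ _ => abs_nonneg _) fun _ _ => hm _ _ _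
              · exact hdiv y _
          _ = _ := one_mul _
    · have h1 := hB3 y hy ξ
      have h2 := hproj y hy ξ (i 0)
      have h3 : ∏ a, ((-y 1 * ξ 0 + y 0 * ξ 1) / ‖y‖ ^ 2 * perp y (Fin.tail i a)) =
          ∑ q : Idx (n + 1), (∏ a, m (Fin.tail i a) (q a) y) * ∏ b, ξ (q b) := by
        have hp := Finset.prod_univ_sum (fun _ : Fin (n + 1) => (Finset.univ : Finset (Fin 2)))
          (fun a c => m (Fin.tail i a) c y * ξ c)
        simp only [Fintype.piFinset_univ, Finset.prod_mul_distrib] at hp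
        rw [← hp]
        refine Finset.prod_congr rfl fun a _ => ?_
        simp [Fin.sum_univ_two, m, perp]
        ring
      rw [Fin.prod_univ_succ, Fin.prod_univ_succ (n := n + 1)]
      change ξ (i 0) * (∏ a, ξ (Fin.tail i a)) - _ * (∏ a, (_ * perp y (Fin.tail i a))) = _
      have h4 : ∑ q : Idx (n + 1), (if q 0 = i 0 then B (Fin.tail q) y else 0) * ∏ b, ξ (q b) =
          ξ (i 0) * ∑ q, B q y * ∏ b, ξ (q b) := by
        rw [sum_idx_succ, Finset.sum_eq_single (i 0)]
        · simp only [Fin.cons_zero, if_true, Fin.tail_cons, Fin.prod_univ_succ, Fin.cons_succ,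
            Finset.mul_sum]
          exact Finset.sum_congr rfl fun q _ => by ring
        · intro b _ hb
          simp [hb]
        · simp
      simp only [add_mul, Finset.sum_add_distrib, h4, mul_assoc (y (i 0) / ‖y‖ ^ 2)]
      rw [← Finset.mul_sum, ← h3]
      linear_combination ξ (i 0) * h1 + (∏ a, ((-y 1 * ξ 0 + y 0 * ξ 1) / ‖y‖ ^ 2 *
        perp y (Fin.tail i a))) * h2

/-- The number of `2`'s in `i` plus the number of `1`'s in `j` is distributed like the number of
`2`'s in a tuple of length `k + ℓ`. -/
lemma sum_numTwos_add {N : Type*} [AddCommMonoid N] (k ℓ : ℕ) (F : ℕ → N) :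
    ∑ i : Idx k, ∑ j : Idx ℓ, F (numTwos i + (ℓ - numTwos j)) =
      ∑ t : Idx (k + ℓ), F (numTwos t) := by
  induction ℓ generalizing F with
  | zero => simp
  | succ ℓ ih =>
    change _ = ∑ t : Idx ((k + ℓ) + 1), F (numTwos t)
    rw [sum_idx_succ]
    simp only [sum_idx_succ (n := ℓ), Finset.sum_add_distrib, Fin.sum_univ_two, numTwos_cons,
      Fin.val_zero, Fin.val_one, add_zero]
    rw [← ih F, ← ih (fun p => F (p + 1)), add_comm]
    congr 1
    · refine Finset.sum_congr rfl fun i _ => Finset.sum_congr rfl fun j _ => ?_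
      congr 1; omega
    · refine Finset.sum_congr rfl fun i _ => Finset.sum_congr rfl fun j _ => ?_
      have := numTwos_le j
      congr 1; omega

lemma traceFreeOf_mul_mono {k ℓ : ℕ} (s : ℕ → ℂ) (ξ : Plane) (i : Idx k) (j : Idx ℓ) :
    traceFreeOf s i j * mono ξ i j = s (numTwos i + (ℓ - numTwos j)) *
      ((ξ 0 : ℂ) ^ (k + ℓ - (numTwos i + (ℓ - numTwos j))) *
        (ξ 1 : ℂ) ^ (numTwos i + (ℓ - numTwos j))) := by
  rw [mono_eq_monoR, monoR_eq, traceFreeOf]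
  have : ((-1 : ℂ) ^ (ℓ - numTwos j)) * (-1) ^ (ℓ - numTwos j) = 1 := by
    rw [← mul_pow]; simp
  rw [zsmul_eq_mul]
  push_cast
  linear_combination (s (numTwos i + (ℓ - numTwos j)) *
    ((ξ 0 : ℂ) ^ (k + ℓ - (numTwos i + (ℓ - numTwos j))) *
        (ξ 1 : ℂ) ^ (numTwos i + (ℓ - numTwos j)))) * this

/-- Every form of degree `k + ℓ` is the restriction of a trace-free bisymmetric tensor: average
its coefficients over the tuples with a given number of twos. -/
lemma sum_traceFreeOf_average {k ℓ : ℕ} (B : Idx (k + ℓ) → ℂ) (ξ : Plane) :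
    ∑ i : Idx k, ∑ j : Idx ℓ, traceFreeOf (fun p =>
        (∑ t : Idx (k + ℓ), if numTwos t = p then B t else 0) /
          (∑ t : Idx (k + ℓ), if numTwos t = p then 1 else 0)) i j * mono ξ i j =
      ∑ t, B t * ∏ b, (ξ (t b) : ℂ) := by
  simp only [traceFreeOf_mul_mono]
  rw [sum_numTwos_add k ℓ (fun p => ((∑ t : Idx (k + ℓ), if numTwos t = p then B t else 0) /
          (∑ t : Idx (k + ℓ), if numTwos t = p then (1 : ℂ) else 0)) *
          ((ξ 0 : ℂ) ^ (k + ℓ - p) * (ξ 1 : ℂ) ^ p))]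
  simp only [Finset.sum_div, Finset.sum_mul]
  rw [Finset.sum_comm]
  refine Finset.sum_congr rfl fun t _ => ?_
  rw [prod_idx (fun c => (ξ c : ℂ))]
  have hcard : (∑ t' : Idx (k + ℓ), if numTwos t' = numTwos t then (1 : ℂ) else 0) ≠ 0 := by
    rw [Finset.sum_boole]
    exact_mod_cast (Finset.card_pos.mpr ⟨t, by simp⟩).ne'
  have : ∀ t' : Idx (k + ℓ), (if numTwos t = numTwos t' then B t else 0) /
      (∑ t'' : Idx (k + ℓ), if numTwos t'' = numTwos t' then (1 : ℂ) else 0) *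
        ((ξ 0 : ℂ) ^ (k + ℓ - numTwos t') * (ξ 1 : ℂ) ^ numTwos t') =
      (if numTwos t' = numTwos t then (1 : ℂ) else 0) *
      (B t / (∑ t'' : Idx (k + ℓ), if numTwos t'' = numTwos t then (1 : ℂ) else 0) *
        ((ξ 0 : ℂ) ^ (k + ℓ - numTwos t) * (ξ 1 : ℂ) ^ numTwos t)) := by
    intro t'
    by_cases h : numTwos t = numTwos t'
    · simp [h]
    · simp [h, Ne.symm h]
  simp only [this]
  rw [← Finset.sum_mul]
  field_simp

/-- The symbol of the potential part: the restriction of a bisymmetric tensor minus that of its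
solenoidal part is divisible by `⟨y, ξ⟩`, and the quotient is the restriction of a trace-free
tensor of size `O(|y|⁻¹)`. -/
lemma exists_traceFree_quotient {k ℓ : ℕ} (i : Idx (k + 1)) (j : Idx ℓ) :
    ∃ s : ℕ → Plane → ℂ, (∀ p, Measurable (s p)) ∧ (∃ c : ℝ, ∀ p y, ‖s p y‖ ≤ c * ‖y‖⁻¹) ∧
      ∀ y : Plane, y ≠ 0 → ∀ ξ : Plane,
        mono ξ i j - (((-y 1 * ξ 0 + y 0 * ξ 1) / ‖y‖ ^ 2 : ℝ) : ℂ) ^ (k + 1 + ℓ) *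
            mono (perp y) i j =
          ((y 0 * ξ 0 + y 1 * ξ 1 : ℝ) : ℂ) *
            ∑ m : Idx k, ∑ n : Idx ℓ, traceFreeOf (fun p => s p y) m n * mono ξ m n := by
  -- up to sign, `mono ξ i j` is the monomial `ξ₁ ^ (k + 1 + ℓ - p) ξ₂ ^ p`
  set p := numTwos i + (ℓ - numTwos j) with hp
  have hple : p ≤ k + ℓ + 1 := by
    have := numTwos_le i
    omega
  obtain ⟨B, hB1, ⟨c, hc⟩, hB3⟩ := exists_quotient (k + ℓ) (stdIdx (k + ℓ + 1) p)
  refine ⟨fun q y => (∑ t : Idx (k + ℓ), if numTwos t = q then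
      (((-1) ^ (ℓ - numTwos j) * B t y : ℝ) : ℂ) else 0) /
          (∑ t : Idx (k + ℓ), if numTwos t = q then 1 else 0), fun q => ?_,
          ⟨(Fintype.card (Idx (k + ℓ)) : ℝ) * |c|, fun q y => ?_⟩, fun y hy ξ => ?_⟩
  · refine Measurable.div_const (Finset.measurable_fun_sum _ fun t _ => ?_) _
    split_ifs
    · exact Complex.measurable_ofReal.comp ((hB1 t).const_mul _)
    · exact measurable_const
  · have hnum : ‖∑ t : Idx (k + ℓ), if numTwos t = q then
        (((-1) ^ (ℓ - numTwos j) * B t y : ℝ) : ℂ) else 0‖ ≤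
        (Fintype.card (Idx (k + ℓ)) : ℝ) * |c| * ‖y‖⁻¹ := by
      refine (norm_sum_le _ _).trans ?_
      have : ∀ t ∈ (Finset.univ : Finset (Idx (k + ℓ))), ‖if numTwos t = q then
        (((-1) ^ (ℓ - numTwos j) * B t y : ℝ) : ℂ) else 0‖ ≤ |c| * ‖y‖⁻¹ := by
        intro t _
        split_ifs
        · rw [Complex.norm_real, norm_mul, norm_pow, norm_neg, norm_one, one_pow, one_mul]
          refine (hc t y).trans ?_
          gcongr
          exact le_abs_self c
        · simp; positivity
      refine (Finset.sum_le_card_nsmul _ _ _ this).trans ?_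
      rw [nsmul_eq_mul, Finset.card_univ, mul_assoc]
    refine le_trans ?_ hnum
    beta_reduce
    rw [Finset.sum_boole, norm_div, Complex.norm_natCast]
    rcases Nat.eq_zero_or_pos (Finset.univ.filter fun t : Idx (k + ℓ) => numTwos t = q).card
      with h | h
    · rw [h]; simp
    · exact div_le_self (norm_nonneg _) (by exact_mod_cast h)
  · rw [sum_traceFreeOf_average]
    have h1 := hB3 y hy ξ
    rw [Finset.prod_mul_distrib, prod_idx (fun c => ξ c), prod_idx (fun c => perp y c),
      numTwos_stdIdx hple, Finset.prod_const, Finset.card_univ, Fintype.card_fin] at h1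
    have h2 := congrArg (fun r : ℝ => (((-1) ^ (ℓ - numTwos j) * r : ℝ) : ℂ)) h1
    simp only [mono_eq_monoR, monoR_eq, ← hp]
    rw [show k + 1 + ℓ = k + ℓ + 1 by omega]
    push_cast at h2 ⊢
    simp only [mul_assoc, ← Finset.mul_sum] at h2 ⊢
    linear_combination h2

end Division

end MixedRay

namespace MixedRay

open MeasureTheory

/-! ### Inverse Fourier transforms of rapidly decreasing functions -/

section RapidL1

/-- Measurable functions all of whose moments are integrable. Their inverse Fourier transforms are
smooth and vanish at infinity. -/
structure RapidL1 (h : Plane → ℂ) : Prop where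
  aesm : AEStronglyMeasurable h volume
  moment : ∀ n : ℕ, Integrable (fun y => ‖y‖ ^ n * ‖h y‖) volume

namespace RapidL1

variable {h g : Plane → ℂ}

lemma integrable (hh : RapidL1 h) : Integrable h := by
  have := hh.moment 0
  simp only [pow_zero, one_mul] at this
  exact (integrable_norm_iff hh.aesm).mp this

lemma of_le (hg : AEStronglyMeasurable g volume) {b : Plane → ℝ}
    (hb : ∀ n : ℕ, Integrable (fun y => ‖y‖ ^ n * b y)) (hle : ∀ y, ‖g y‖ ≤ b y) : RapidL1 g := by
  refine ⟨hg, fun n => (hb n).mono' ?_ (Filter.Eventually.of_forall fun y => ?_)⟩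
  · exact (continuous_norm.pow n).aestronglyMeasurable.mul hg.norm
  · rw [Real.norm_of_nonneg (by positivity)]
    exact mul_le_mul_of_nonneg_left (hle y) (by positivity)

lemma const_mul (hh : RapidL1 h) (c : ℂ) : RapidL1 (fun y => c * h y) :=
  of_le (hh.aesm.const_mul c) (b := fun y => ‖c‖ * ‖h y‖)
    (fun n => by simpa only [mul_left_comm] using (hh.moment n).const_mul ‖c‖)
    (fun y => (norm_mul _ _).le)

lemma sum {ι : Type*} (s : Finset ι) {F : ι → Plane → ℂ} (hF : ∀ i ∈ s, RapidL1 (F i)) :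
    RapidL1 (fun y => ∑ i ∈ s, F i y) :=
  of_le (b := fun y => ∑ i ∈ s, ‖F i y‖)
    (Finset.aestronglyMeasurable_fun_sum s fun i hi => (hF i hi).aesm)
    (fun n => by
      simp only [Finset.mul_sum]
      exact integrable_finsetSum _ fun i hi => (hF i hi).moment n) (fun y => norm_sum_le _ _)

lemma coord_mul (hh : RapidL1 h) (a : Fin 2) : RapidL1 (fun y => (y a : ℂ) * h y) := by
  refine of_le (b := fun y => ‖y‖ * ‖h y‖) ?_
    (fun n => by simpa only [pow_succ, mul_assoc] using hh.moment (n + 1)) (fun y => ?_)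
  · have : Continuous fun y : Plane => (y a : ℂ) := by fun_prop
    exact this.aestronglyMeasurable.mul hh.aesm
  · rw [norm_mul, Complex.norm_real]
    gcongr
    exact PiLp.norm_apply_le y a

lemma schwartz (φ : 𝓢(Plane, ℂ)) : RapidL1 φ :=
  ⟨φ.continuous.aestronglyMeasurable, fun n => φ.integrable_pow_mul volume n⟩

lemma contDiff (hh : RapidL1 h) : ContDiff ℝ ∞ (𝓕⁻ h) := by
  rw [Real.fourierInv_eq_fourier_comp_neg]
  refine Real.contDiff_fourier (N := ⊤) fun n _ => ?_
  have := (hh.moment n).comp_neg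
  simpa using this

lemma tendsto_cocompact (h : Plane → ℂ) :
    Filter.Tendsto (𝓕⁻ h) (Filter.cocompact Plane) (nhds 0) := by
  have h1 := tendsto_integral_exp_inner_smul_cocompact (V := Plane) (fun y => h (-y))
  rw [Real.fourierInv_eq_fourier_comp_neg]
  exact h1.congr fun w => (Real.fourier_eq _ w).symm

lemma fourierInv_const_mul (c : ℂ) (h : Plane → ℂ) (x : Plane) :
    𝓕⁻ (fun y => c * h y) x = c * 𝓕⁻ h x := by
  simp only [Real.fourierInv_eq, ← integral_const_mul]
  congr 1; funext y
  simp [Circle.smul_def]; ring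

lemma fourierInv_sum {ι : Type*} (s : Finset ι) {F : ι → Plane → ℂ}
    (hF : ∀ i ∈ s, Integrable (F i)) (x : Plane) :
    𝓕⁻ (fun y => ∑ i ∈ s, F i y) x = ∑ i ∈ s, 𝓕⁻ (F i) x := by
  simp only [Real.fourierInv_eq, Finset.smul_sum]
  refine integral_finsetSum _ fun i hi => ?_
  have := (Real.fourierIntegral_convergent_iff (-x)).mpr (hF i hi)
  simpa using this

lemma fourierInv_add (hh : RapidL1 h) (hg : RapidL1 g) (x : Plane) :
    𝓕⁻ (fun y => h y + g y) x = 𝓕⁻ h x + 𝓕⁻ g x := by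
  have hs := fourierInv_sum (Finset.univ : Finset (Fin 2)) (F := ![h, g])
    (fun i _ => by fin_cases i; exacts [hh.integrable, hg.integrable]) x
  simpa only [Fin.sum_univ_two, Matrix.cons_val_zero, Matrix.cons_val_one] using hs

/-- Symbols may be changed at the origin. -/
lemma fourierInv_congr {h g : Plane → ℂ} (he : ∀ y, y ≠ 0 → h y = g y) (x : Plane) :
    𝓕⁻ h x = 𝓕⁻ g x := by
  refine Real.fourierInv_congr_ae ?_ x
  filter_upwards [(Set.countable_singleton (0 : Plane)).ae_notMem volume] with y hy
  exact he y hy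

/-- A partial derivative of an inverse Fourier transform. -/
lemma pd_fourierInv (hh : RapidL1 h) (a : Fin 2) (x : Plane) :
    pd a (𝓕⁻ h) x = 𝓕⁻ (fun y => 2 * Real.pi * Complex.I * ((y a : ℂ) * h y)) x := by
  have hn1 : Integrable (fun y => h (-y)) := hh.integrable.comp_neg
  have hn2 : Integrable (fun y : Plane => ‖y‖ * ‖h (-y)‖) := by
    simpa using (hh.moment 1).comp_neg
  unfold pd
  rw [Real.fourierInv_eq_fourier_comp_neg, Real.fderiv_fourier hn1 hn2,
    Real.fourierInv_eq_fourier_comp_neg]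
  have hint : Integrable (VectorFourier.fourierSMulRight (innerSL ℝ) fun y => h (-y)) := by
    refine (hn2.const_mul (2 * Real.pi * ‖(innerSL ℝ : Plane →L[ℝ] Plane →L[ℝ] ℝ)‖)).mono'
      hn1.1.fourierSMulRight (Filter.Eventually.of_forall fun y => ?_)
    simpa only [mul_assoc] using VectorFourier.norm_fourierSMulRight_le _ _ y
  rw [Real.fourier_continuousLinearMap_apply hint]
  refine congrArg (fun g : Plane → ℂ => 𝓕 g x) (funext fun y => ?_)
  have hin : (innerSL ℝ) y (EuclideanSpace.single a (1 : ℝ)) = y a := by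
    rw [innerSL_apply_apply, EuclideanSpace.inner_single_right]
    simp
  rw [VectorFourier.fourierSMulRight_apply, hin]
  simp

end RapidL1

lemma exists_decay (g : 𝓢(Plane, ℂ)) :
    ∃ C : ℝ, 0 ≤ C ∧ ∀ y, ‖g y‖ ≤ C * ((1 + ‖y‖) ^ 2)⁻¹ := by
  refine ⟨2 ^ 2 * (Finset.Iic (2, 0)).sup (fun m => SchwartzMap.seminorm ℂ m.1 m.2) g,
    mul_nonneg (by positivity) (apply_nonneg _ _), fun y => ?_⟩
  have := SchwartzMap.one_add_le_sup_seminorm_apply (𝕜 := ℂ) (m := (2, 0)) (k := 2) (n := 0)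
    le_rfl le_rfl g y
  rw [norm_iteratedFDeriv_zero] at this
  rw [← div_eq_mul_inv, le_div_iff₀ (by positivity), mul_comm]
  exact this

/-- In the plane `|y|⁻¹` is integrable against rapidly decreasing functions. -/
lemma integrable_inv_norm_mul (g : 𝓢(Plane, ℂ)) :
    Integrable (fun y : Plane => ‖y‖⁻¹ * ‖g y‖) := by
  obtain ⟨C, -, hC⟩ := exists_decay g
  have h1 : Integrable (fun y : Plane => ‖y‖⁻¹ * (1 + ‖y‖) ^ (-2 : ℝ)) := by
    rw [integrable_fun_norm_addHaar volume (f := fun r => r⁻¹ * (1 + r) ^ (-2 : ℝ))]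
    have h2 : Integrable (fun r : ℝ => (1 + ‖r‖) ^ (-2 : ℝ)) :=
      integrable_one_add_norm (by simp)
    refine h2.integrableOn.congr_fun (fun r hr => ?_) measurableSet_Ioi
    have hr : 0 < r := hr
    simp only [finrank_euclideanSpace, Fintype.card_fin, Real.norm_of_nonneg hr.le]
    simp [hr.ne']
  refine (h1.const_mul C).mono' ?_ (Filter.Eventually.of_forall fun y => ?_)
  · exact (continuous_norm.measurable.inv.aestronglyMeasurable).mul
      g.continuous.norm.aestronglyMeasurable
  · rw [Real.norm_of_nonneg (by positivity), Real.rpow_neg (by positivity), mul_left_comm]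
    refine mul_le_mul_of_nonneg_left ?_ (by positivity)
    exact_mod_cast hC y

/-- A function of size `O(|y|⁻¹ |g y|)` with `g` Schwartz: the singularity at the origin is
integrable in the plane. -/
lemma RapidL1.of_le_inv_norm {h : Plane → ℂ} (hm : AEStronglyMeasurable h volume)
    (g : 𝓢(Plane, ℂ)) {c : ℝ} (hle : ∀ y, ‖h y‖ ≤ c * ‖y‖⁻¹ * ‖g y‖) : RapidL1 h := by
  refine RapidL1.of_le hm (b := fun y => c * ‖y‖⁻¹ * ‖g y‖) (fun n => ?_) hle
  cases n with
  | zero => simpa [mul_assoc] using (integrable_inv_norm_mul g).const_mul c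
  | succ n =>
    refine ((g.integrable_pow_mul volume n).const_mul c).congr ?_
    filter_upwards [(Set.countable_singleton (0 : Plane)).ae_notMem volume] with y hy
    have : ‖y‖ ≠ 0 := norm_ne_zero_iff.mpr hy
    field_simp
    ring

end RapidL1

/-! ### Existence of the decomposition -/

section Existence

variable {k ℓ : ℕ}

lemma norm_perp (y : Plane) : ‖perp y‖ = ‖y‖ := by
  simp [EuclideanSpace.norm_eq, perp, Fin.sum_univ_two, add_comm]

lemma continuous_perp : Continuous perp := by
  unfold perp
  fun_prop

lemma norm_mono_le (ξ : Plane) (i : Idx k) (j : Idx ℓ) : ‖mono ξ i j‖ ≤ ‖ξ‖ ^ (k + ℓ) := by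
  rw [mono, Complex.norm_real, norm_mul, norm_prod, norm_prod, pow_add]
  gcongr
  · exact (Finset.prod_le_prod (fun _ _ => norm_nonneg _)
      fun a _ => PiLp.norm_apply_le ξ (i a)).trans (by simp)
  · refine (Finset.prod_le_prod (fun _ _ => norm_nonneg _)
      fun a _ => PiLp.norm_apply_le (perp ξ) (j a)).trans ?_
    simp [norm_perp]

lemma continuous_mono (i : Idx k) (j : Idx ℓ) : Continuous fun ξ => mono ξ i j := by
  unfold mono
  have := continuous_perp
  fun_prop

lemma mono_comp_perm_left (ξ : Plane) (π : Equiv.Perm (Fin k)) (i : Idx k) (j : Idx ℓ) :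
    mono ξ (i ∘ π) j = mono ξ i j := by
  rw [mono_eq_monoR, mono_eq_monoR]
  exact monoR_comp_perm _ i j π 1

lemma mono_comp_perm_right (ξ : Plane) (π : Equiv.Perm (Fin ℓ)) (i : Idx k) (j : Idx ℓ) :
    mono ξ i (j ∘ π) = mono ξ i j := by
  rw [mono_eq_monoR, mono_eq_monoR]
  exact monoR_comp_perm _ i j 1 π

/-- The Schwartz function underlying a component of a compactly supported smooth field. -/
noncomputable def IsSmoothSymCompact.component {f : TField k ℓ} (hf : IsSmoothSymCompact f)
    (i : Idx k) (j : Idx ℓ) : 𝓢(Plane, ℂ) :=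
  (hf.compact i j).toSchwartzMap (hf.smooth i j)

/-- The Fourier transform of the solenoidal part: the orthogonal projection of the Fourier
transform `F y` to the line spanned by `ω ⊗ ⋯ ⊗ ω ⊗ ω^⊥ ⊗ ⋯ ⊗ ω^⊥`, where `ω = y^⊥ / |y|`. -/
noncomputable def solHat (F : Idx k → Idx ℓ → 𝓢(Plane, ℂ)) (m : Idx k) (n : Idx ℓ)
    (y : Plane) : ℂ :=
  (∑ i, ∑ j, F i j y * mono (perp y) i j) / (‖y‖ : ℂ) ^ (2 * (k + ℓ)) * mono (perp y) m n

lemma rapidL1_solHat (F : Idx k → Idx ℓ → 𝓢(Plane, ℂ)) (m : Idx k) (n : Idx ℓ) :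
    RapidL1 (solHat F m n) := by
  have hc : ∀ (m : Idx k) (n : Idx ℓ), Continuous fun y => mono (perp y) m n := fun m n =>
    (continuous_mono m n).comp continuous_perp
  refine RapidL1.of_le (b := fun y => ∑ i, ∑ j, ‖F i j y‖) ?_ (fun N => ?_) (fun y => ?_)
  · refine Measurable.aestronglyMeasurable ?_
    refine Measurable.mul (Measurable.div ?_ ?_) (hc m n).measurable
    · have : Continuous fun y => ∑ i, ∑ j, F i j y * mono (perp y) i j :=
        continuous_finsetSum _ fun i _ => continuous_finsetSum _ fun j _ =>
          (F i j).continuous.mul (hc i j)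
      exact this.measurable
    · have : Continuous fun y : Plane => (‖y‖ : ℂ) ^ (2 * (k + ℓ)) := by fun_prop
      exact this.measurable
  · simp only [Finset.mul_sum]
    exact integrable_finsetSum _ fun i _ => integrable_finsetSum _ fun j _ =>
      (F i j).integrable_pow_mul volume N
  · have h1 : ‖∑ i, ∑ j, F i j y * mono (perp y) i j‖ ≤
        (∑ i, ∑ j, ‖F i j y‖) * ‖y‖ ^ (k + ℓ) := by
      simp only [Finset.sum_mul]
      refine (norm_sum_le _ _).trans (Finset.sum_le_sum fun i _ => ?_)
      refine (norm_sum_le _ _).trans (Finset.sum_le_sum fun j _ => ?_)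
      rw [norm_mul]
      gcongr
      simpa [norm_perp] using norm_mono_le (perp y) i j
    have h2 : ‖mono (perp y) m n‖ ≤ ‖y‖ ^ (k + ℓ) := by
      simpa [norm_perp] using norm_mono_le (perp y) m n
    have h0 : 0 ≤ ∑ i, ∑ j, ‖F i j y‖ :=
      Finset.sum_nonneg fun _ _ => Finset.sum_nonneg fun _ _ => norm_nonneg _
    rw [solHat, norm_mul, norm_div, norm_pow, Complex.norm_real, norm_norm, div_mul_eq_mul_div]
    refine div_le_of_le_mul₀ (by positivity) h0 ?_
    calc _ ≤ ((∑ i, ∑ j, ‖F i j y‖) * ‖y‖ ^ (k + ℓ)) * ‖y‖ ^ (k + ℓ) := by gcongr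
      _ = _ := by ring

/-- The inverse Fourier transform of `solHat F`. For `F = 𝓕 f` it is the solenoidal part of `f`. -/
noncomputable def solPart (F : Idx k → Idx ℓ → 𝓢(Plane, ℂ)) : TField k ℓ :=
  fun m n => 𝓕⁻ (solHat F m n)

lemma isSmoothSym_solPart (F : Idx k → Idx ℓ → 𝓢(Plane, ℂ)) : IsSmoothSym (solPart F) where
  smooth i j := (rapidL1_solHat F i j).contDiff
  symm_left π i j := by
    simp only [solPart]; congr 1; funext y; simp only [solHat, mono_comp_perm_left]
  symm_right π i j := by
    simp only [solPart]; congr 1; funext y; simp only [solHat, mono_comp_perm_right]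

lemma vanishesAtInfinity_solPart (F : Idx k → Idx ℓ → 𝓢(Plane, ℂ)) :
    VanishesAtInfinity (solPart F) := fun _ _ => RapidL1.tendsto_cocompact _

lemma isTraceFree_solPart (F : Idx k → Idx ℓ → 𝓢(Plane, ℂ)) : IsTraceFree (solPart F) := by
  cases k with
  | zero => trivial
  | succ k =>
    cases ℓ with
    | zero => trivial
    | succ ℓ =>
      funext i j x
      simp only [trace, solPart]
      rw [← RapidL1.fourierInv_sum _ fun a _ => (rapidL1_solHat F _ _).integrable]
      have : (fun y => ∑ a : Fin 2, solHat F (Fin.cons a i) (Fin.cons a j) y) =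
          fun y => 0 * (1 : ℂ) := by
        funext y
        simp only [solHat, mono_eq_monoR, monoR_cons_left, monoR_cons_right]
        simp [Fin.sum_univ_two, perp]
        ring
      rw [this, RapidL1.fourierInv_const_mul]
      simp

lemma isDivFree_solPart (F : Idx k → Idx ℓ → 𝓢(Plane, ℂ)) : IsDivFree (solPart F) := by
  cases k with
  | zero => trivial
  | succ k =>
    funext i j x
    simp only [divPrime, solPart]
    rw [Finset.sum_congr rfl fun a _ => (rapidL1_solHat F (Fin.cons a i) j).pd_fourierInv a x,
      ← RapidL1.fourierInv_sum _ fun a _ =>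
        (((rapidL1_solHat F (Fin.cons a i) j).coord_mul a).const_mul _).integrable]
    have : (fun y : Plane => ∑ a : Fin 2, 2 * Real.pi * Complex.I *
        ((y a : ℂ) * solHat F (Fin.cons a i) j y)) = fun y => 0 * (1 : ℂ) := by
      funext y
      simp only [solHat, mono_eq_monoR, monoR_cons_left]
      simp [Fin.sum_univ_two, perp]
      ring
    rw [this, RapidL1.fourierInv_const_mul]
    simp

/-- The restriction of `solHat F y` to `ξ` sees only the projection of `ξ` to the line orthogonal
to `y`. -/
lemma sum_solHat_mul_mono (F : Idx k → Idx ℓ → 𝓢(Plane, ℂ)) (y ξ : Plane) :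
    ∑ m, ∑ n, solHat F m n y * mono ξ m n =
      (∑ i, ∑ j, F i j y * mono (perp y) i j) *
        (((-y 1 * ξ 0 + y 0 * ξ 1) / ‖y‖ ^ 2 : ℝ) : ℂ) ^ (k + ℓ) := by
  have h := sum_monoR_mul_monoR (k := k) (ℓ := ℓ) (fun a => (perp y a : ℂ)) (fun a => (ξ a : ℂ))
  simp only [solHat, mul_assoc, ← Finset.mul_sum]
  simp only [mono_eq_monoR ξ, mono_eq_monoR (perp y)] at h ⊢
  rw [h]
  push_cast
  rw [div_pow, ← pow_mul, div_mul_eq_mul_div, mul_div_assoc]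
  simp [perp]

lemma sum_fourierInv_mul_mono {H : Idx k → Idx ℓ → Plane → ℂ} (hH : ∀ i j, RapidL1 (H i j))
    (x ξ : Plane) :
    ∑ i, ∑ j, 𝓕⁻ (H i j) x * mono ξ i j = 𝓕⁻ (fun y => ∑ i, ∑ j, mono ξ i j * H i j y) x := by
  rw [RapidL1.fourierInv_sum _ fun i _ => (RapidL1.sum _ fun j _ =>
    (hH i j).const_mul _).integrable]
  refine Finset.sum_congr rfl fun i _ => ?_
  rw [RapidL1.fourierInv_sum _ fun j _ => ((hH i j).const_mul _).integrable]
  refine Finset.sum_congr rfl fun j _ => ?_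
  rw [RapidL1.fourierInv_const_mul, mul_comm]

lemma isSmoothSym_dPrime {u : TField k ℓ} (hu : IsSmoothSym u) : IsSmoothSym (dPrime u) := by
  refine ⟨fun i j => ?_, fun σ i j => ?_, fun σ i j => ?_⟩
  · unfold dPrime
    refine contDiff_const.mul (ContDiff.sum fun π _ => ?_)
    exact ((hu.smooth _ _).fderiv_right (m := ∞) (by simp)).clm_apply contDiff_const
  · funext x
    simp only [dPrime]
    congr 1
    exact Equiv.sum_comp (Equiv.mulLeft σ) (fun π : Equiv.Perm (Fin (k + 1)) =>
      pd (i (π 0)) (u (fun a => i (π a.succ)) j) x)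
  · funext x
    simp only [dPrime, hu.symm_right]

/-- Restricted to `(ξ, …, ξ, ξ^⊥, …, ξ^⊥)`, the operator `d'` is the derivative along `ξ`. -/
lemma sum_dPrime_mul_mono (u : TField k ℓ) (x ξ : Plane) :
    ∑ i, ∑ j, dPrime u i j x * mono ξ i j =
      ∑ a, (ξ a : ℂ) * ∑ m, ∑ n, pd a (u m n) x * mono ξ m n := by
  have h := contr_symmetrize (fun a => (ξ a : ℂ)) (fun a m n => pd a (u m n) x)
  have h1 : ((k + 1).factorial : ℂ) ≠ 0 := by exact_mod_cast (Nat.factorial_pos _).ne'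
  simp only [contr, smul_eq_mul, ← mono_eq_monoR] at h
  simp only [mul_comm _ (mono ξ _ _)]
  rw [← mul_right_inj' h1, ← h, Finset.mul_sum]
  refine Finset.sum_congr rfl fun i _ => ?_
  rw [Finset.mul_sum]
  refine Finset.sum_congr rfl fun j _ => ?_
  simp only [dPrime]
  field_simp

/-- The Fourier transform of the potential: at each `y ≠ 0` the restrictions of `F y` and of
`solHat F y` differ by `2 π i ⟨y, ξ⟩` times the restriction of a trace-free tensor. -/
lemma exists_potentialHat (F : Idx (k + 1) → Idx ℓ → 𝓢(Plane, ℂ)) :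
    ∃ s : ℕ → Plane → ℂ, (∀ p, RapidL1 (s p)) ∧ ∀ y : Plane, y ≠ 0 → ∀ ξ : Plane,
      ∑ i, ∑ j, mono ξ i j * F i j y = ∑ i, ∑ j, mono ξ i j * solHat F i j y +
        2 * Real.pi * Complex.I * ((y 0 * ξ 0 + y 1 * ξ 1 : ℝ) : ℂ) *
          ∑ m : Idx k, ∑ n : Idx ℓ, mono ξ m n * traceFreeOf (fun p => s p y) m n := by
  choose s hs1 hs2 hs3 using fun (i : Idx (k + 1)) (j : Idx ℓ) => exists_traceFree_quotient i j
  choose c hc using hs2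
  refine ⟨fun p y => (2 * Real.pi * Complex.I)⁻¹ * ∑ i, ∑ j, F i j y * s i j p y, fun p => ?_,
    fun y hy ξ => ?_⟩
  · refine RapidL1.const_mul (RapidL1.sum _ fun i _ => RapidL1.sum _ fun j _ => ?_) _
    refine RapidL1.of_le_inv_norm ?_ (F i j) (c := c i j) fun y => ?_
    · exact (F i j).continuous.aestronglyMeasurable.mul (hs1 i j p).aestronglyMeasurable
    · rw [norm_mul, mul_comm]
      gcongr
      exact hc i j p y
  · have hpi : (2 * Real.pi * Complex.I : ℂ) ≠ 0 := Complex.two_pi_I_ne_zero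
    have h1 : ∑ m : Idx k, ∑ n : Idx ℓ, mono ξ m n * traceFreeOf (fun p =>
        (2 * Real.pi * Complex.I)⁻¹ * ∑ i, ∑ j, F i j y * s i j p y) m n =
        (2 * Real.pi * Complex.I)⁻¹ * ∑ i, ∑ j, F i j y *
          ∑ m : Idx k, ∑ n : Idx ℓ, traceFreeOf (fun p => s i j p y) m n * mono ξ m n := by
      have h2 : ∀ (m : Idx k) (n : Idx ℓ), mono ξ m n * traceFreeOf (fun p =>
          (2 * Real.pi * Complex.I)⁻¹ * ∑ i, ∑ j, F i j y * s i j p y) m n =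
          ∑ i, ∑ j, (2 * Real.pi * Complex.I)⁻¹ *
            (F i j y * (traceFreeOf (fun p => s i j p y) m n * mono ξ m n)) := by
        intro m n
        simp only [traceFreeOf, zsmul_eq_mul, Finset.mul_sum]
        exact Finset.sum_congr rfl fun i _ => Finset.sum_congr rfl fun j _ => by ring
      have hswap : ∀ X : Idx k → Idx ℓ → Idx (k + 1) → Idx ℓ → ℂ,
          ∑ m, ∑ n, ∑ i, ∑ j, X m n i j = ∑ i, ∑ j, ∑ m, ∑ n, X m n i j := fun X =>
        calc ∑ m, ∑ n, ∑ i, ∑ j, X m n i j = ∑ m, ∑ i, ∑ j, ∑ n, X m n i j :=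
              Finset.sum_congr rfl fun m _ => by
                rw [Finset.sum_comm]
                exact Finset.sum_congr rfl fun i _ => Finset.sum_comm
          _ = ∑ i, ∑ j, ∑ m, ∑ n, X m n i j := by
                rw [Finset.sum_comm]
                exact Finset.sum_congr rfl fun i _ => Finset.sum_comm
      simp only [h2]
      rw [hswap]
      simp only [Finset.mul_sum]
    have h3 : ∑ i, ∑ j, F i j y * (mono ξ i j -
        (((-y 1 * ξ 0 + y 0 * ξ 1) / ‖y‖ ^ 2 : ℝ) : ℂ) ^ (k + 1 + ℓ) * mono (perp y) i j) =
        ((y 0 * ξ 0 + y 1 * ξ 1 : ℝ) : ℂ) * ∑ i, ∑ j, F i j y *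
          ∑ m : Idx k, ∑ n : Idx ℓ, traceFreeOf (fun p => s i j p y) m n * mono ξ m n := by
      rw [Finset.mul_sum]
      refine Finset.sum_congr rfl fun i _ => ?_
      rw [Finset.mul_sum]
      refine Finset.sum_congr rfl fun j _ => ?_
      rw [hs3 i j y hy ξ]
      ring
    have h4 := sum_solHat_mul_mono F y ξ
    simp only [mul_comm (mono ξ _ _) (solHat F _ _ y)]
    rw [h4, h1, mul_comm (2 * Real.pi * Complex.I : ℂ), mul_assoc, mul_inv_cancel_left₀ hpi, ← h3,
      Finset.sum_mul, ← Finset.sum_add_distrib]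
    refine Finset.sum_congr rfl fun i _ => ?_
    rw [Finset.sum_mul, ← Finset.sum_add_distrib]
    exact Finset.sum_congr rfl fun j _ => by ring

/-- The decomposition of a compactly supported field into its solenoidal part, a potential and a
field in the range of `λ`. The last summand is what remains; it is in the range of `λ` because its
restriction to `(ξ, …, ξ, ξ^⊥, …, ξ^⊥)` vanishes. -/
lemma isSolenoidalPart_solPart {f : TField k ℓ} (hkℓ : 1 ≤ k ∨ ℓ = 0)
    (hf : IsSmoothSymCompact f) :
    IsSolenoidalPart f (solPart fun i j => 𝓕 (hf.component i j)) := by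
  generalize hFdef : (fun i j => 𝓕 (hf.component i j)) = F
  have hfF : ∀ i j, f i j = 𝓕⁻ (F i j : Plane → ℂ) := by
    intro i j
    rw [← hFdef, ← SchwartzMap.fourierInv_coe, FourierTransform.fourierInv_fourier_eq]
    rfl
  refine ⟨isSmoothSym_solPart F, isDivFree_solPart F, isTraceFree_solPart F,
    vanishesAtInfinity_solPart F, ?_⟩
  cases k with
  | zero =>
    -- a field without indices is its own solenoidal part
    obtain rfl : ℓ = 0 := by omega
    refine ⟨0, 0, rfl, rfl, ?_⟩
    funext i j
    rw [Pi.add_apply, Pi.add_apply, Pi.add_apply, Pi.add_apply]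
    rw [show (0 : TField 0 0) i j = 0 from rfl, add_zero, add_zero, hfF, solPart]
    congr 1
    funext y
    have h0 : ∀ a b, F a b y = F i j y := fun a b => by
      rw [Subsingleton.elim a i, Subsingleton.elim b j]
    simp [solHat, mono, h0]
  | succ k =>
    obtain ⟨s, hs1, hs2⟩ := exists_potentialHat F
    have hr : ∀ (m : Idx k) (n : Idx ℓ), RapidL1 fun y => traceFreeOf (fun p => s p y) m n := by
      intro m n
      simp only [traceFreeOf, zsmul_eq_mul]
      exact (hs1 _).const_mul _
    let u : TField k ℓ := fun m n => 𝓕⁻ (fun y => traceFreeOf (fun p => s p y) m n)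
    have hu : IsSmoothSym u := by
      refine ⟨fun m n => (hr m n).contDiff, fun π m n => ?_, fun π m n => ?_⟩
      · simp only [u, traceFreeOf, numTwos_comp_perm]
      · simp only [u, traceFreeOf, numTwos_comp_perm]
    have hut : IsTraceFree u := by
      cases k with
      | zero => trivial
      | succ k =>
        cases ℓ with
        | zero => trivial
        | succ ℓ =>
          funext m n x
          simp only [trace, u]
          rw [← RapidL1.fourierInv_sum _ fun a _ => (hr _ _).integrable]
          simp only [traceFreeOf_trace]
          have := RapidL1.fourierInv_const_mul 0 0 x
          simpa using this
    refine ⟨dPrime u, f - solPart F - dPrime u, ⟨u, hu, hut, fun _ _ =>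
      RapidL1.tendsto_cocompact _, rfl⟩, ?_, by abel⟩
    have hsol := isSmoothSym_solPart F
    have hdu := isSmoothSym_dPrime hu
    refine isLam_of_restriction_eq_zero ⟨fun i j => ?_, fun π i j => ?_, fun π i j => ?_⟩
      fun x ξ => ?_
    · exact ((hf.smooth i j).sub (hsol.smooth i j)).sub (hdu.smooth i j)
    · simp only [Pi.sub_apply, hf.symm_left, hsol.symm_left, hdu.symm_left]
    · simp only [Pi.sub_apply, hf.symm_right, hsol.symm_right, hdu.symm_right]
    · -- all three terms are inverse Fourier transforms, and their symbols cancel off the origin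
      have hr' : ∀ (a : Fin 2) (m : Idx k) (n : Idx ℓ), RapidL1 fun y : Plane =>
          2 * Real.pi * Complex.I * ((y a : ℂ) * traceFreeOf (fun p => s p y) m n) :=
        fun a m n => ((hr m n).coord_mul a).const_mul _
      have hr1 : RapidL1 (fun y => ∑ i, ∑ j, mono ξ i j * solHat F i j y) :=
        RapidL1.sum _ fun i _ => RapidL1.sum _ fun j _ => (rapidL1_solHat F i j).const_mul _
      have hr2 : ∀ a, RapidL1 (fun y : Plane => (ξ a : ℂ) * ∑ m : Idx k, ∑ n : Idx ℓ,
          mono ξ m n * (2 * Real.pi * Complex.I *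
            ((y a : ℂ) * traceFreeOf (fun p => s p y) m n))) := fun a =>
        (RapidL1.sum _ fun m _ => RapidL1.sum _ fun n _ => (hr' a m n).const_mul _).const_mul _
      have e1 : ∑ i, ∑ j, f i j x * mono ξ i j =
          𝓕⁻ (fun y => ∑ i, ∑ j, mono ξ i j * F i j y) x := by
        simp only [hfF]
        exact sum_fourierInv_mul_mono (fun i j => RapidL1.schwartz (F i j)) x ξ
      have e2 : ∑ i, ∑ j, solPart F i j x * mono ξ i j =
          𝓕⁻ (fun y => ∑ i, ∑ j, mono ξ i j * solHat F i j y) x :=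
        sum_fourierInv_mul_mono (rapidL1_solHat F) x ξ
      have e3 : ∑ i, ∑ j, dPrime u i j x * mono ξ i j =
          𝓕⁻ (fun y => ∑ a, (ξ a : ℂ) * ∑ m : Idx k, ∑ n : Idx ℓ, mono ξ m n *
            (2 * Real.pi * Complex.I * ((y a : ℂ) * traceFreeOf (fun p => s p y) m n))) x := by
        rw [sum_dPrime_mul_mono, RapidL1.fourierInv_sum _ fun a _ => (hr2 a).integrable]
        refine Finset.sum_congr rfl fun a _ => ?_
        rw [RapidL1.fourierInv_const_mul, ← sum_fourierInv_mul_mono (hr' a)]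
        simp only [u, (hr _ _).pd_fourierInv a x]
      simp only [Pi.sub_apply, sub_mul, Finset.sum_sub_distrib]
      rw [e1, e2, e3, sub_sub, ← RapidL1.fourierInv_add hr1 (RapidL1.sum _ fun a _ => hr2 a),
        sub_eq_zero]
      refine RapidL1.fourierInv_congr (fun y hy => ?_) x
      rw [hs2 y hy ξ, Fin.sum_univ_two]
      congr 1
      simp only [Finset.mul_sum, ← Finset.sum_add_distrib]
      refine Finset.sum_congr rfl fun m _ => Finset.sum_congr rfl fun n _ => ?_
      push_cast
      ring

end Existence

end MixedRay

namespace MixedRay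

open MeasureTheory

/-! ### Decay along lines -/

section Decay

/-- Uniform decay along a line parametrized so that `|t| ≤ ‖y‖`. -/
lemma exists_decay_of_le (g : 𝓢(Plane, ℂ)) :
    ∃ C : ℝ, 0 ≤ C ∧ ∀ (y : Plane) (t : ℝ), |t| ≤ ‖y‖ → ‖g y‖ ≤ C * ((1 + |t|) ^ 2)⁻¹ := by
  obtain ⟨C, hC0, hC⟩ := exists_decay g
  refine ⟨C, hC0, fun y t ht => (hC y).trans ?_⟩
  gcongr

lemma integrable_weight : Integrable (fun t : ℝ => ((1 + |t|) ^ 2)⁻¹) := by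
  have := integrable_one_add_norm (μ := (volume : Measure ℝ)) (r := 2) (by simp)
  refine this.congr (Filter.Eventually.of_forall fun t => ?_)
  simp only [Real.norm_eq_abs]
  rw [Real.rpow_neg (by positivity)]
  norm_cast

end Decay

/-! ### The Fourier slice theorem -/

section Frame

lemma continuous_dir : Continuous dir := by
  unfold dir
  fun_prop

lemma continuous_perp_dir : Continuous fun θ => perp (dir θ) := continuous_perp.comp continuous_dir

lemma norm_dir (θ : ℝ) : ‖dir θ‖ = 1 := by
  simp [EuclideanSpace.norm_eq, dir, Fin.sum_univ_two]

lemma perp_dir (θ : ℝ) : perp (dir θ) = dir (θ + Real.pi / 2) := by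
  ext a
  fin_cases a <;> simp [perp, dir, Real.cos_add_pi_div_two, Real.sin_add_pi_div_two]

lemma dir_add_pi (θ : ℝ) : dir (θ + Real.pi) = -dir θ := by
  ext a
  fin_cases a <;> simp [dir]

lemma dir_add_two_pi (θ : ℝ) : dir (θ + 2 * Real.pi) = dir θ := by
  ext a
  fin_cases a <;> simp [dir]

lemma norm_frame_sq (θ a b : ℝ) : ‖a • dir θ + b • perp (dir θ)‖ ^ 2 = a ^ 2 + b ^ 2 := by
  rw [EuclideanSpace.real_norm_sq_eq, Fin.sum_univ_two]
  simp [dir, perp]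
  have := Real.sin_sq_add_cos_sq θ
  linear_combination (a ^ 2 + b ^ 2) * this

lemma abs_le_norm_frame (θ a b : ℝ) : |b| ≤ ‖a • dir θ + b • perp (dir θ)‖ := by
  refine abs_le_of_sq_le_sq ?_ (norm_nonneg _)
  rw [norm_frame_sq]
  nlinarith [sq_nonneg a]

lemma inner_dir_frame (θ a b t : ℝ) :
    inner ℝ (a • dir θ + b • perp (dir θ)) (t • dir θ) = t * a := by
  simp only [PiLp.inner_apply, Fin.sum_univ_two, dir, perp]
  simp
  have := Real.sin_sq_add_cos_sq θ
  linear_combination (t * a) * this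

/-- The coordinates in the orthonormal frame `(dir θ, perp (dir θ))` preserve the measure. -/
lemma measurePreserving_frame (θ : ℝ) :
    MeasurePreserving (fun p : ℝ × ℝ => p.1 • dir θ + p.2 • perp (dir θ)) volume volume := by
  let A : Plane →ₗᵢ[ℝ] Plane :=
    { toFun := fun p => p 0 • dir θ + p 1 • perp (dir θ)
      map_add' := fun p q => by simp only [PiLp.add_apply, add_smul]; abel
      map_smul' := fun c p => by simp [mul_smul]
      norm_map' := fun p => by
        have h : ‖p 0 • dir θ + p 1 • perp (dir θ)‖ ^ 2 = ‖p‖ ^ 2 := by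
          rw [norm_frame_sq, EuclideanSpace.real_norm_sq_eq, Fin.sum_univ_two]
        exact (sq_eq_sq₀ (norm_nonneg _) (norm_nonneg _)).mp h }
  have h1 := (A.toLinearIsometryEquiv rfl).measurePreserving
  have h2 := (PiLp.volume_preserving_toLp (Fin 2)).comp
    (volume_preserving_finTwoArrow ℝ).symm
  exact h1.comp h2

lemma measurableEmbedding_frame (θ : ℝ) :
    MeasurableEmbedding (fun p : ℝ × ℝ => p.1 • dir θ + p.2 • perp (dir θ)) := by
  have hc : Continuous (fun p : ℝ × ℝ => p.1 • dir θ + p.2 • perp (dir θ)) := by fun_prop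
  refine hc.measurableEmbedding fun p q hpq => ?_
  have h := norm_frame_sq θ (p.1 - q.1) (p.2 - q.2)
  have h0 : (p.1 - q.1) • dir θ + (p.2 - q.2) • perp (dir θ) = 0 := by
    rw [sub_smul, sub_smul]
    have hpq : p.1 • dir θ + p.2 • perp (dir θ) = q.1 • dir θ + q.2 • perp (dir θ) := hpq
    rw [← sub_eq_zero] at hpq
    rw [← hpq]; abel
  rw [h0, norm_zero] at h
  have h1 : (p.1 - q.1) ^ 2 = 0 := by nlinarith [sq_nonneg (p.1 - q.1), sq_nonneg (p.2 - q.2)]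
  have h2 : (p.2 - q.2) ^ 2 = 0 := by nlinarith [sq_nonneg (p.1 - q.1), sq_nonneg (p.2 - q.2)]
  ext
  · exact sub_eq_zero.mp (pow_eq_zero_iff two_ne_zero |>.mp h1)
  · exact sub_eq_zero.mp (pow_eq_zero_iff two_ne_zero |>.mp h2)

lemma integral_frame (θ : ℝ) (H : Plane → ℂ) :
    ∫ p : ℝ × ℝ, H (p.1 • dir θ + p.2 • perp (dir θ)) = ∫ y, H y :=
  (measurePreserving_frame θ).integral_comp (measurableEmbedding_frame θ) H

lemma integrable_line (g : 𝓢(Plane, ℂ)) {v : Plane} (hv : ‖v‖ = 1) :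
    Integrable (fun t : ℝ => g (t • v)) := by
  obtain ⟨C, -, hC⟩ := exists_decay_of_le g
  refine (integrable_weight.const_mul C).mono' ?_ (Filter.Eventually.of_forall fun t => ?_)
  · exact (g.continuous.comp (by fun_prop)).aestronglyMeasurable
  · exact hC _ t (by simp [norm_smul, hv])

/-- The Fourier slice theorem at the origin: the integral of `𝓕 ψ` over a line through the origin
is the integral of `ψ` over the orthogonal line. -/
lemma integral_fourier_line (ψ : 𝓢(Plane, ℂ)) (θ : ℝ) :
    ∫ t : ℝ, 𝓕 (ψ : Plane → ℂ) (t • dir θ) = ∫ s : ℝ, ψ (s • perp (dir θ)) := by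
  -- `g` integrates `ψ` over the lines orthogonal to `dir θ`; its Fourier transform is the
  -- restriction of `𝓕 ψ` to the line spanned by `dir θ`, and Fourier inversion at `0` gives the
  -- claim
  set g : ℝ → ℂ := fun a => ∫ b : ℝ, ψ (a • dir θ + b • perp (dir θ)) with hg
  have hψ : Integrable (fun p : ℝ × ℝ => ψ (p.1 • dir θ + p.2 • perp (dir θ))) :=
    (measurePreserving_frame θ).integrable_comp_of_integrable ψ.integrable
  have hgi : Integrable g := hψ.integral_prod_left
  have hgc : Continuous g := by
    obtain ⟨C, -, hC⟩ := exists_decay_of_le ψ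
    refine continuous_of_dominated (bound := fun b => C * ((1 + |b|) ^ 2)⁻¹)
      (fun a => ?_) (fun a => ?_) (integrable_weight.const_mul C) ?_
    · exact (ψ.continuous.comp (by fun_prop)).aestronglyMeasurable
    · exact Filter.Eventually.of_forall fun b => hC _ b (abs_le_norm_frame θ a b)
    · exact Filter.Eventually.of_forall fun b => ψ.continuous.comp (by fun_prop)
  have hF : ∀ t : ℝ, 𝓕 g t = 𝓕 (ψ : Plane → ℂ) (t • dir θ) := by
    intro t
    rw [Real.fourier_eq, Real.fourier_eq, ← integral_frame θ]
    simp only [inner_dir_frame]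
    have hint : Integrable (fun p : ℝ × ℝ => Real.fourierChar (-(t * p.1)) •
        ψ (p.1 • dir θ + p.2 • perp (dir θ))) := by
      refine hψ.mono ?_ (Filter.Eventually.of_forall fun p => by simp [Circle.norm_smul])
      have : Continuous (fun p : ℝ × ℝ => Real.fourierChar (-(t * p.1)) •
        ψ (p.1 • dir θ + p.2 • perp (dir θ))) :=
        (Real.continuous_fourierChar.comp (by fun_prop)).smul (ψ.continuous.comp (by fun_prop))
      exact this.aestronglyMeasurable
    refine Eq.trans ?_ (integral_prod (μ := volume) (ν := volume) _ hint).symm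
    refine integral_congr_ae (Filter.Eventually.of_forall fun a => ?_)
    simp only [hg, Circle.smul_def, integral_const_mul, smul_eq_mul]
    congr 2
  have hFi : Integrable (𝓕 g) := by
    have := integrable_line (𝓕 ψ) (norm_dir θ)
    rw [SchwartzMap.fourier_coe] at this
    exact this.congr (Filter.Eventually.of_forall fun t => (hF t).symm)
  have hinv := hgi.fourierInv_fourier_eq hFi (v := 0) hgc.continuousAt
  rw [Real.fourierInv_eq] at hinv
  simp only [hF, inner_zero_right, AddChar.map_zero_eq_one, one_smul] at hinv
  rw [hinv, hg]
  simp

end Frame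

/-! ### Pairings with Fourier transforms -/

section Pairing

/-- The multiplication formula: the Fourier transform of `𝓕⁻ h` as a distribution is `h`. -/
lemma integral_mul_fourierInv (φ : 𝓢(Plane, ℂ)) {h : Plane → ℂ} (hh : Integrable h) :
    ∫ x, 𝓕 φ x * 𝓕⁻ h x = ∫ y, φ y * h y := by
  have h1 := VectorFourier.integral_fourierIntegral_smul_eq_flip (L := innerₗ Plane)
    (μ := volume) (ν := volume) Real.continuous_fourierChar continuous_inner
    (f := fun x => (𝓕 φ : 𝓢(Plane, ℂ)) (-x)) (g := h) ((𝓕 φ).integrable.comp_neg) hh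
  rw [flip_innerₗ] at h1
  have h2 : ∀ y, φ y = 𝓕 (fun x => (𝓕 φ : 𝓢(Plane, ℂ)) (-x)) y := by
    intro y
    rw [← Real.fourierInv_eq_fourier_comp_neg, ← SchwartzMap.fourierInv_coe,
      FourierTransform.fourierInv_fourier_eq]
  simp only [h2]
  refine Eq.trans ?_ h1.symm
  rw [← integral_neg_eq_self]
  refine integral_congr_ae (Filter.Eventually.of_forall fun x => ?_)
  simp only [Real.fourierInv_eq_fourier_neg, neg_neg, smul_eq_mul]
  rfl

/-- The pairing of `𝓕 φ` with a translate of `g` is an inverse Fourier transform at the translation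
vector. -/
lemma integral_fourier_mul_translate (φ g : 𝓢(Plane, ℂ)) (v : Plane) :
    ∫ x, 𝓕 φ x * g (x + v) = 𝓕⁻ (fun y => φ y * (𝓕 g : 𝓢(Plane, ℂ)) y) v := by
  set h : Plane → ℂ := fun y => Real.fourierChar (inner ℝ y v) • (𝓕 g : 𝓢(Plane, ℂ)) y with hdef
  have hh : Integrable h := by
    refine (𝓕 g).integrable.mono ?_ (Filter.Eventually.of_forall fun y => by
      simp [hdef, Circle.norm_smul])
    have : Continuous h :=
      (Real.continuous_fourierChar.comp (by fun_prop)).smul (𝓕 g).continuous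
    exact this.aestronglyMeasurable
  have h1 : ∀ x, g (x + v) = 𝓕⁻ h x := by
    intro x
    have h2 : g = 𝓕⁻ (𝓕 g) := (FourierTransform.fourierInv_fourier_eq g).symm
    have h3 := congrArg (fun q : 𝓢(Plane, ℂ) => q (x + v)) h2
    simp only [SchwartzMap.fourierInv_coe] at h3
    rw [h3, Real.fourierInv_eq, Real.fourierInv_eq]
    refine integral_congr_ae (Filter.Eventually.of_forall fun y => ?_)
    simp only [hdef, inner_add_right, AddChar.map_add_eq_mul, mul_smul]
  simp only [h1]
  rw [integral_mul_fourierInv φ hh, Real.fourierInv_eq]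
  refine integral_congr_ae (Filter.Eventually.of_forall fun y => ?_)
  simp only [hdef, Circle.smul_def, smul_eq_mul]
  ring

/-- The Fourier slice theorem for the product of two Schwartz functions. -/
lemma integral_line_fourierInv (φ g : 𝓢(Plane, ℂ)) (θ : ℝ) :
    ∫ t : ℝ, 𝓕⁻ (fun y => φ y * g y) (t • dir θ) =
      ∫ s : ℝ, φ (s • perp (dir θ)) * g (s • perp (dir θ)) := by
  have h := integral_fourier_line (SchwartzMap.pairing (ContinuousLinearMap.mul ℂ ℂ) φ g) θ
  simp only [SchwartzMap.pairing_apply_apply, ContinuousLinearMap.mul_apply'] at h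
  rw [← h, ← integral_neg_eq_self]
  refine integral_congr_ae (Filter.Eventually.of_forall fun t => ?_)
  simp only [Real.fourierInv_eq_fourier_neg, neg_smul, neg_neg]
  rfl

end Pairing

end MixedRay

namespace MixedRay

open MeasureTheory

/-! ### Superpositions of ray integrals -/

section Rays

lemma abs_le_norm_smul_dir (t θ : ℝ) : |t| ≤ ‖t • dir θ‖ := by
  simp [norm_smul, norm_dir]

/-- The Fourier transform of a superposition of ray integrals: Fubini and the Fourier slice
theorem. -/
lemma integral_fourier_mul_rays (φ g : 𝓢(Plane, ℂ)) {b : ℝ → ℂ} (hb : Continuous b) {B : ℝ}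
    (hB : ∀ θ, ‖b θ‖ ≤ B) :
    ∫ x, 𝓕 φ x * ∫ θ in (0 : ℝ)..(2 * Real.pi), b θ * ∫ t : ℝ, g (x + t • dir θ) =
      ∫ θ in (0 : ℝ)..(2 * Real.pi), b θ * ∫ s : ℝ,
        φ (s • perp (dir θ)) * (𝓕 g : 𝓢(Plane, ℂ)) (s • perp (dir θ)) := by
  obtain ⟨C, hC0, hC⟩ := exists_decay g
  have h2pi : (0 : ℝ) ≤ 2 * Real.pi := by positivity
  set μ : Measure ℝ := volume.restrict (Set.Ioc 0 (2 * Real.pi))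
  let Φ : Plane → ℝ × ℝ → ℂ := fun x p => 𝓕 φ x * (b p.1 * g (x + p.2 • dir p.1))
  have hB0 : 0 ≤ B := (norm_nonneg _).trans (hB 0)
  have hΦ : Integrable (Function.uncurry Φ) (volume.prod (μ.prod volume)) := by
    have hA : Integrable (fun x : Plane => ‖𝓕 φ x‖ * (1 + ‖x‖) ^ 2) := by
      have h0 := (𝓕 φ).integrable_pow_mul volume 0
      have h1 := (𝓕 φ).integrable_pow_mul volume 1
      have h2 := (𝓕 φ).integrable_pow_mul volume 2
      refine ((h0.add (h1.const_mul 2)).add h2).congr (Filter.Eventually.of_forall fun x => ?_)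
      simp only [Pi.add_apply]
      ring
    have hW : Integrable (fun p : ℝ × ℝ => (1 : ℝ) * ((1 + |p.2|) ^ 2)⁻¹) (μ.prod volume) :=
      (integrable_const (1 : ℝ)).mul_prod integrable_weight
    refine ((hA.mul_prod hW).const_mul (B * C)).mono' ?_
      (Filter.Eventually.of_forall fun q => ?_)
    · have h1 : Continuous fun q : Plane × ℝ × ℝ => q.1 + q.2.2 • dir q.2.1 :=
        continuous_fst.add (continuous_snd.snd.smul (continuous_dir.comp continuous_snd.fst))
      have : Continuous (Function.uncurry Φ) :=
        ((𝓕 φ).continuous.comp continuous_fst).mul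
          ((hb.comp continuous_snd.fst).mul (g.continuous.comp h1))
      exact this.aestronglyMeasurable
    · obtain ⟨x, θ, t⟩ := q
      simp only [Function.uncurry_apply_pair, Φ, norm_mul, one_mul]
      have h1 : 1 + |t| ≤ (1 + ‖x + t • dir θ‖) * (1 + ‖x‖) := by
        have h2 : |t| ≤ ‖x + t • dir θ‖ + ‖x‖ := by
          calc |t| ≤ ‖t • dir θ‖ := abs_le_norm_smul_dir t θ
            _ = ‖(x + t • dir θ) - x‖ := by simp
            _ ≤ _ := norm_sub_le _ _
        nlinarith [mul_nonneg (norm_nonneg (x + t • dir θ)) (norm_nonneg x)]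
      have h3 : ((1 + ‖x + t • dir θ‖) ^ 2)⁻¹ ≤ (1 + ‖x‖) ^ 2 * ((1 + |t|) ^ 2)⁻¹ := by
        rw [← div_eq_mul_inv, le_div_iff₀ (by positivity), mul_comm, ← div_eq_mul_inv,
          div_le_iff₀ (by positivity), ← mul_pow, mul_comm (1 + ‖x‖)]
        gcongr
      calc ‖(𝓕 φ : 𝓢(Plane, ℂ)) x‖ * (‖b θ‖ * ‖g (x + t • dir θ)‖)
          ≤ ‖(𝓕 φ : 𝓢(Plane, ℂ)) x‖ * (B * (C * ((1 + ‖x‖) ^ 2 * ((1 + |t|) ^ 2)⁻¹))) := by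
            gcongr
            · exact hB θ
            · exact (hC _).trans (by gcongr)
        _ = _ := by ring
  calc ∫ x, 𝓕 φ x * ∫ θ in (0 : ℝ)..(2 * Real.pi), b θ * ∫ t : ℝ, g (x + t • dir θ)
      = ∫ x, ∫ p, Φ x p ∂(μ.prod volume) := by
        refine integral_congr_ae ?_
        filter_upwards [hΦ.prod_right_ae] with x hx
        refine Eq.trans ?_ (integral_prod _ hx).symm
        rw [intervalIntegral.integral_of_le h2pi]
        simp only [Φ, Function.uncurry_apply_pair, integral_const_mul]
        rfl
    _ = ∫ p, ∫ x, Φ x p ∂volume ∂(μ.prod volume) := integral_integral_swap hΦ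
    _ = ∫ θ, ∫ t, ∫ x, Φ x (θ, t) ∂volume ∂volume ∂μ := integral_prod _ hΦ.integral_prod_right
    _ = _ := by
        rw [intervalIntegral.integral_of_le h2pi]
        refine integral_congr_ae (Filter.Eventually.of_forall fun θ => ?_)
        simp only [Φ]
        rw [← integral_line_fourierInv, ← integral_const_mul]
        refine integral_congr_ae (Filter.Eventually.of_forall fun t => ?_)
        simp only
        rw [← integral_fourier_mul_translate, ← integral_const_mul]
        exact integral_congr_ae (Filter.Eventually.of_forall fun x => by ring)

/-- Integration in polar coordinates: integrating over all lines through the origin covers the plane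
with density `2 / |y|`, each line occurring for two opposite directions. -/
lemma integral_lines_eq (H : 𝓢(Plane, ℂ)) {β : Plane → ℂ} (hβc : Continuous fun θ => β (dir θ))
    {B : ℝ} (hB : ∀ v, ‖β v‖ ≤ B) (hβ : ∀ c : ℝ, c ≠ 0 → ∀ v, β (c • v) = β v) :
    ∫ θ in (0 : ℝ)..(2 * Real.pi), β (perp (dir θ)) * ∫ s : ℝ, H (s • perp (dir θ)) =
      ∫ y, 2 * (‖y‖ : ℂ)⁻¹ * (β y * H y) := by
  obtain ⟨C, hC0, hC⟩ := exists_decay_of_le H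
  have hB0 : 0 ≤ B := (norm_nonneg _).trans (hB 0)
  set A : ℝ → ℂ := fun θ => β (dir θ) * ∫ r in Set.Ioi (0 : ℝ), H (r • dir θ) with hA
  have hAc : Continuous A := by
    refine hβc.mul (continuous_of_dominated (bound := fun r => C * ((1 + |r|) ^ 2)⁻¹)
      (fun θ => ?_) (fun θ => ?_) (integrable_weight.const_mul C).integrableOn ?_)
    · exact (H.continuous.comp (by fun_prop)).aestronglyMeasurable
    · exact Filter.Eventually.of_forall fun r => hC _ r (abs_le_norm_smul_dir r θ)
    · exact Filter.Eventually.of_forall fun r =>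
        H.continuous.comp (continuous_dir.const_smul r)
  have hAp : Function.Periodic A (2 * Real.pi) := fun θ => by
    simp only [hA, dir_add_two_pi]
  -- each line consists of two half-lines
  have hlhs : ∀ θ, β (perp (dir θ)) * ∫ s : ℝ, H (s • perp (dir θ)) =
      A (θ + Real.pi / 2) + A (θ + (Real.pi / 2 + Real.pi)) := by
    intro θ
    rw [perp_dir]
    have hi := integrable_line H (norm_dir (θ + Real.pi / 2))
    rw [← intervalIntegral.integral_Iic_add_Ioi (b := 0) hi.integrableOn hi.integrableOn]
    have h1 := integral_comp_neg_Ioi (0 : ℝ) (fun s => H (s • dir (θ + Real.pi / 2)))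
    rw [neg_zero] at h1
    rw [← h1]
    simp only [hA, ← add_assoc θ, dir_add_pi, smul_neg, neg_smul]
    rw [← neg_one_smul ℝ (dir (θ + Real.pi / 2)), hβ (-1) (by norm_num)]
    ring
  have hshift : ∀ c : ℝ, ∫ θ in (0 : ℝ)..(2 * Real.pi), A (θ + c) =
      ∫ θ in (-Real.pi)..Real.pi, A θ := by
    intro c
    rw [intervalIntegral.integral_comp_add_right]
    have h := hAp.intervalIntegral_add_eq (0 + c) (-Real.pi)
    rw [show -Real.pi + 2 * Real.pi = Real.pi by ring, show 0 + c + 2 * Real.pi =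
      2 * Real.pi + c by ring] at h
    exact h
  have hint : IntegrableOn (fun p : ℝ × ℝ => 2 * (β (dir p.2) * H (p.1 • dir p.2)))
      (Set.Ioi 0 ×ˢ Set.Ioo (-Real.pi) Real.pi) (volume.prod volume) := by
    rw [IntegrableOn, ← Measure.prod_restrict]
    have hW : Integrable (fun p : ℝ × ℝ => ((1 + |p.1|) ^ 2)⁻¹ * (1 : ℝ))
        ((volume.restrict (Set.Ioi 0)).prod (volume.restrict (Set.Ioo (-Real.pi) Real.pi))) :=
      integrable_weight.integrableOn.mul_prod (integrable_const (1 : ℝ))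
    refine (hW.const_mul (2 * (B * C))).mono' ?_ (Filter.Eventually.of_forall fun p => ?_)
    · have : Continuous fun p : ℝ × ℝ => 2 * (β (dir p.2) * H (p.1 • dir p.2)) :=
        continuous_const.mul ((hβc.comp continuous_snd).mul
          (H.continuous.comp (continuous_fst.smul (continuous_dir.comp continuous_snd))))
      exact this.aestronglyMeasurable
    · rw [norm_mul, norm_mul]
      calc ‖(2 : ℂ)‖ * (‖β (dir p.2)‖ * ‖H (p.1 • dir p.2)‖)
          ≤ 2 * (B * (C * ((1 + |p.1|) ^ 2)⁻¹)) := by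
            gcongr
            · simp
            · exact hB _
            · exact hC _ _ (abs_le_norm_smul_dir _ _)
        _ = _ := by ring
  have hrhs : ∫ y, 2 * (‖y‖ : ℂ)⁻¹ * (β y * H y) = 2 * ∫ θ in (-Real.pi)..Real.pi, A θ := by
    rw [← integral_frame 0, ← integral_comp_polarCoord_symm]
    have hpt : ∀ p ∈ polarCoord.target, p.1 • (2 * (‖(polarCoord.symm p).1 • dir 0 +
        (polarCoord.symm p).2 • perp (dir 0)‖ : ℂ)⁻¹ * (β ((polarCoord.symm p).1 • dir 0 +
        (polarCoord.symm p).2 • perp (dir 0)) * H ((polarCoord.symm p).1 • dir 0 +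
        (polarCoord.symm p).2 • perp (dir 0)))) = 2 * (β (dir p.2) * H (p.1 • dir p.2)) := by
      intro p hp
      have hp1 : 0 < p.1 := by
        rw [polarCoord_target] at hp
        exact hp.1
      have hd : (polarCoord.symm p).1 • dir 0 + (polarCoord.symm p).2 • perp (dir 0) =
          p.1 • dir p.2 := by
        rw [polarCoord_symm_apply]
        ext a
        fin_cases a <;> simp [dir, perp]
      have hp2 : (p.1 : ℂ) ≠ 0 := by exact_mod_cast hp1.ne'
      rw [hd, hβ p.1 hp1.ne', norm_smul, norm_dir, mul_one, Real.norm_of_nonneg hp1.le,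
        Complex.real_smul]
      field_simp
    rw [setIntegral_congr_fun polarCoord.open_target.measurableSet hpt, polarCoord_target,
      Measure.volume_eq_prod, setIntegral_prod _ hint,
      intervalIntegral.integral_of_le (by linarith [Real.pi_pos]), integral_Ioc_eq_integral_Ioo]
    rw [IntegrableOn, ← Measure.prod_restrict] at hint
    rw [integral_integral_swap hint, ← integral_const_mul]
    simp only [hA, integral_const_mul]
  rw [hrhs]
  simp only [hlhs]
  rw [intervalIntegral.integral_add (f := fun θ => A (θ + Real.pi / 2))
    (g := fun θ => A (θ + (Real.pi / 2 + Real.pi)))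
    ((hAc.comp (continuous_add_const _)).intervalIntegrable _ _)
    ((hAc.comp (continuous_add_const _)).intervalIntegrable _ _), hshift, hshift, two_mul]

end Rays

/-! ### The Fourier transform of the normal operator -/

section Normal

variable {k ℓ : ℕ}

/-- The ray integrals of a rapidly decreasing function are jointly continuous and bounded. -/
lemma continuous_bounded_rays (g : 𝓢(Plane, ℂ)) :
    (Continuous fun q : Plane × ℝ => ∫ t : ℝ, g (q.1 + t • dir q.2)) ∧
      ∃ C : ℝ, ∀ x θ, ‖∫ t : ℝ, g (x + t • dir θ)‖ ≤ C := by
  obtain ⟨C, hC0, hC⟩ := exists_decay_of_le g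
  -- started at the foot of the perpendicular from the origin, the ray satisfies `|t| ≤ ‖y‖`
  have hshift : ∀ (x : Plane) (θ : ℝ), ∫ t : ℝ, g (x + t • dir θ) =
      ∫ t : ℝ, g (x - (inner ℝ x (dir θ)) • dir θ + t • dir θ) := by
    intro x θ
    rw [← integral_sub_right_eq_self (fun t : ℝ => g (x + t • dir θ)) (inner ℝ x (dir θ))]
    refine integral_congr_ae (Filter.Eventually.of_forall fun t => ?_)
    simp only [sub_smul]
    congr 1
    abel
  have hle : ∀ (x : Plane) (t θ : ℝ),
      |t| ≤ ‖x - (inner ℝ x (dir θ)) • dir θ + t • dir θ‖ := by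
    intro x t θ
    have h1 : inner ℝ (x - (inner ℝ x (dir θ)) • dir θ + t • dir θ) (dir θ) = t := by
      rw [inner_add_left, inner_sub_left, real_inner_smul_left, real_inner_smul_left,
        real_inner_self_eq_norm_sq, norm_dir]
      ring
    calc |t| = |inner ℝ (x - (inner ℝ x (dir θ)) • dir θ + t • dir θ) (dir θ)| := by rw [h1]
      _ ≤ _ := abs_real_inner_le_norm _ _
      _ = _ := by rw [norm_dir, mul_one]
  constructor
  · rw [funext fun q : Plane × ℝ => hshift q.1 q.2]
    refine continuous_of_dominated (bound := fun t => C * ((1 + |t|) ^ 2)⁻¹)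
      (fun q => ?_) (fun q => ?_) (integrable_weight.const_mul C) ?_
    · exact (g.continuous.comp (by fun_prop)).aestronglyMeasurable
    · exact Filter.Eventually.of_forall fun t => hC _ t (hle _ _ _)
    · refine Filter.Eventually.of_forall fun t => g.continuous.comp ?_
      have := continuous_dir
      fun_prop
  · refine ⟨∫ t : ℝ, C * ((1 + |t|) ^ 2)⁻¹, fun x θ => ?_⟩
    rw [hshift]
    exact norm_integral_le_of_norm_le (integrable_weight.const_mul C)
      (Filter.Eventually.of_forall fun t => hC _ t (hle _ _ _))

/-- A component of the normal operator as a superposition of ray integrals. -/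
lemma normalOp_eq {f : TField k ℓ} (hf : IsSmoothSymCompact f) (m : Idx k) (n : Idx ℓ)
    (x : Plane) :
    normalOp f m n x = ∑ i, ∑ j, ∫ θ in (0 : ℝ)..(2 * Real.pi),
      (mono (dir θ) m n * mono (dir θ) i j) * ∫ t : ℝ, hf.component i j (x + t • dir θ) := by
  have hcont : ∀ i j, Continuous fun θ : ℝ => (mono (dir θ) m n * mono (dir θ) i j) *
      ∫ t : ℝ, hf.component i j (x + t • dir θ) := fun i j =>
    (((continuous_mono m n).comp continuous_dir).mul
      ((continuous_mono i j).comp continuous_dir)).mul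
      ((continuous_bounded_rays (hf.component i j)).1.comp (Continuous.prodMk_right x))
  simp only [normalOp, mixedRayAdjoint]
  rw [Finset.sum_congr rfl fun i _ => (intervalIntegral.integral_finsetSum
    fun j _ => (hcont i j).intervalIntegrable _ _).symm,
    ← intervalIntegral.integral_finsetSum fun i _ =>
      (continuous_finsetSum _ fun j _ => hcont i j).intervalIntegrable _ _]
  refine intervalIntegral.integral_congr fun θ _ => ?_
  have hint : ∀ i j, Integrable fun t : ℝ => f i j (x + t • dir θ) := by
    intro i j
    have hc : Continuous fun t : ℝ => f i j (x + t • dir θ) :=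
      (hf.smooth i j).continuous.comp (by fun_prop)
    refine hc.integrable_of_hasCompactSupport ?_
    refine (hf.compact i j).comp_isClosedEmbedding ?_
    have h0 : dir θ ≠ 0 := by
      intro h
      have := norm_dir θ
      rw [h, norm_zero] at this
      exact zero_ne_one this
    exact (Homeomorph.addLeft x).isClosedEmbedding.comp (isClosedEmbedding_smul_left h0)
  simp only [mixedRay]
  have hshift : ∫ t : ℝ, ∑ i, ∑ j, f i j (x - (inner ℝ x (dir θ)) • dir θ + t • dir θ) *
      mono (dir θ) i j = ∫ t : ℝ, ∑ i, ∑ j, f i j (x + t • dir θ) * mono (dir θ) i j := by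
    rw [← integral_sub_right_eq_self (fun t : ℝ => ∑ i, ∑ j, f i j (x + t • dir θ) *
      mono (dir θ) i j) (inner ℝ x (dir θ))]
    refine integral_congr_ae (Filter.Eventually.of_forall fun t => ?_)
    have hx : x - (inner ℝ x (dir θ)) • dir θ + t • dir θ =
        x + (t - inner ℝ x (dir θ)) • dir θ := by
      rw [sub_smul]; abel
    simp only [hx]
  rw [hshift, integral_finsetSum _ fun i _ => integrable_finsetSum _ fun j _ =>
    (hint i j).mul_const _, Finset.mul_sum]
  refine Finset.sum_congr rfl fun i _ => ?_
  rw [integral_finsetSum _ fun j _ => (hint i j).mul_const _, Finset.mul_sum]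
  refine Finset.sum_congr rfl fun j _ => ?_
  rw [integral_mul_const]
  change mono (dir θ) m n * ((∫ t : ℝ, hf.component i j (x + t • dir θ)) * mono (dir θ) i j) = _
  ring

lemma continuous_bounded_superposition (g : 𝓢(Plane, ℂ)) {b : ℝ → ℂ} (hb : Continuous b) {B : ℝ}
    (hB : ∀ θ, ‖b θ‖ ≤ B) :
    (Continuous fun x => ∫ θ in (0 : ℝ)..(2 * Real.pi), b θ * ∫ t : ℝ, g (x + t • dir θ)) ∧
      ∃ C : ℝ, ∀ x, ‖∫ θ in (0 : ℝ)..(2 * Real.pi), b θ * ∫ t : ℝ, g (x + t • dir θ)‖ ≤ C := by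
  obtain ⟨hc, C, hC⟩ := continuous_bounded_rays g
  have hB0 : 0 ≤ B := (norm_nonneg _).trans (hB 0)
  refine ⟨intervalIntegral.continuous_parametric_intervalIntegral_of_continuous'
    ((hb.comp continuous_snd).mul hc) _ _, B * C * |2 * Real.pi - 0|, fun x =>
    intervalIntegral.norm_integral_le_of_norm_le_const fun θ _ => ?_⟩
  rw [norm_mul]
  exact mul_le_mul (hB θ) (hC x θ) (norm_nonneg _) hB0

/-- A bounded continuous function is a tempered distribution. -/
lemma exists_isGivenBy {h : Plane → ℂ} (hc : Continuous h) {C : ℝ} (hC : ∀ x, ‖h x‖ ≤ C) :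
    ∃ S : 𝓢'(Plane, ℂ), IsGivenBy S h := by
  have hmem : MemLp h ⊤ volume :=
    memLp_top_of_bound hc.aestronglyMeasurable C (Filter.Eventually.of_forall hC)
  refine ⟨Lp.toTemperedDistribution (hmem.toLp h), fun φ => ⟨?_, ?_⟩⟩
  · exact φ.integrable.mul_bdd (c := C) hc.aestronglyMeasurable (Filter.Eventually.of_forall hC)
  · rw [Lp.toTemperedDistribution_apply]
    refine integral_congr_ae ?_
    filter_upwards [hmem.coeFn_toLp] with x hx
    rw [hx, smul_eq_mul]

/-- The Fourier transform of a component of the normal operator is `2 / |y|` times that of the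
solenoidal part. -/
lemma integral_fourier_mul_normalOp {f : TField k ℓ} (hf : IsSmoothSymCompact f)
    (m : Idx k) (n : Idx ℓ) (φ : 𝓢(Plane, ℂ)) :
    Integrable (fun y : Plane => φ y * (2 * (‖y‖ : ℂ)⁻¹ *
      solHat (fun i j => 𝓕 (hf.component i j)) m n y)) ∧
    ∫ x, 𝓕 φ x * normalOp f m n x = ∫ y, φ y * (2 * (‖y‖ : ℂ)⁻¹ *
      solHat (fun i j => 𝓕 (hf.component i j)) m n y) := by
  -- the coefficients of the projection in `solHat`, homogeneous of degree zero; at `(dir θ)^⊥` they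
  -- are the weights of the normal operator
  let β : Idx k → Idx ℓ → Plane → ℂ := fun i j y =>
    mono (perp y) i j * mono (perp y) m n / (‖y‖ : ℂ) ^ (2 * (k + ℓ))
  have hperp2 : ∀ v, perp (perp v) = (-1 : ℝ) • v := by
    intro v
    ext a
    fin_cases a <;> simp [perp]
  have hmono_smul : ∀ (c : ℝ) (v : Plane) (i : Idx k) (j : Idx ℓ),
      mono (c • v) i j = (c : ℂ) ^ (k + ℓ) * mono v i j := by
    intro c v i j
    rw [mono_eq_monoR, mono_eq_monoR, ← monoR_smul]
    simp
  have hperp_smul : ∀ (c : ℝ) (v : Plane), perp (c • v) = c • perp v := by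
    intro c v
    ext a
    fin_cases a <;> simp [perp]
  have hβb : ∀ i j v, ‖β i j v‖ ≤ 1 := by
    intro i j v
    simp only [β]
    rw [norm_div, norm_mul, norm_pow, Complex.norm_real, norm_norm]
    refine div_le_one_of_le₀ ?_ (by positivity)
    rw [two_mul, pow_add]
    have h1 := norm_mono_le (perp v) i j
    have h2 := norm_mono_le (perp v) m n
    rw [norm_perp] at h1 h2
    gcongr
  have hβh : ∀ i j (c : ℝ), c ≠ 0 → ∀ v, β i j (c • v) = β i j v := by
    intro i j c hc v
    simp only [β, hperp_smul, hmono_smul, norm_smul]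
    have h1 : (c : ℂ) ≠ 0 := by exact_mod_cast hc
    have h2 : ((|c| : ℝ) : ℂ) ^ (2 * (k + ℓ)) = (c : ℂ) ^ (2 * (k + ℓ)) := by
      rw [pow_mul, pow_mul, ← Complex.ofReal_pow, ← Complex.ofReal_pow, sq_abs]
      push_cast
      rfl
    rw [Real.norm_eq_abs, Complex.ofReal_mul, mul_pow, h2, two_mul, pow_add]
    field_simp
    ring
  have hβc : ∀ i j, Continuous fun θ => β i j (dir θ) := by
    intro i j
    have : (fun θ => β i j (dir θ)) = fun θ =>
        mono (perp (dir θ)) i j * mono (perp (dir θ)) m n := by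
      funext θ
      simp [β, norm_dir]
    rw [this]
    exact ((continuous_mono i j).comp continuous_perp_dir).mul
      ((continuous_mono m n).comp continuous_perp_dir)
  have hβd : ∀ i j θ, mono (dir θ) m n * mono (dir θ) i j = β i j (perp (dir θ)) := by
    intro i j θ
    simp only [β, hperp2, norm_perp, norm_dir, hmono_smul]
    have h1 : ((-1 : ℝ) : ℂ) ^ (k + ℓ) * ((-1 : ℝ) : ℂ) ^ (k + ℓ) = 1 := by
      rw [← mul_pow]; simp
    rw [Complex.ofReal_one, one_pow, div_one]
    linear_combination -(mono (dir θ) m n * mono (dir θ) i j) * h1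
  have hbc : ∀ i j, Continuous fun θ => β i j (perp (dir θ)) := by
    intro i j
    simp only [perp_dir]
    exact (hβc i j).comp (continuous_add_const _)
  let Hs : Idx k → Idx ℓ → 𝓢(Plane, ℂ) := fun i j =>
    SchwartzMap.pairing (ContinuousLinearMap.mul ℂ ℂ) φ (𝓕 (hf.component i j))
  have hHs : ∀ i j y, Hs i j y = φ y * (𝓕 (hf.component i j) : 𝓢(Plane, ℂ)) y :=
    fun i j y => rfl
  have hint : ∀ i j, Integrable fun y : Plane => 2 * (‖y‖ : ℂ)⁻¹ * (β i j y * Hs i j y) := by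
    intro i j
    refine ((integrable_inv_norm_mul (Hs i j)).const_mul 2).mono' ?_
      (Filter.Eventually.of_forall fun y => ?_)
    · have hm : ∀ (i : Idx k) (j : Idx ℓ), Measurable fun y => mono (perp y) i j := fun i j =>
        ((continuous_mono i j).comp continuous_perp).measurable
      have hn : Measurable fun y : Plane => (‖y‖ : ℂ) :=
        Complex.measurable_ofReal.comp measurable_norm
      exact ((measurable_const.mul hn.inv).mul
        ((((hm i j).mul (hm m n)).div (hn.pow_const _)).mul
          (Hs i j).continuous.measurable)).aestronglyMeasurable
    · rw [norm_mul, norm_mul, norm_mul, norm_inv, Complex.norm_real, norm_norm, Complex.norm_ofNat,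
        mul_assoc]
      have := hβb i j y
      have h3 : ‖β i j y‖ * ‖Hs i j y‖ ≤ 1 * ‖Hs i j y‖ := by gcongr
      rw [one_mul] at h3
      gcongr
  have hsum : ∀ y : Plane, φ y * (2 * (‖y‖ : ℂ)⁻¹ *
      solHat (fun i j => 𝓕 (hf.component i j)) m n y) =
      ∑ i, ∑ j, 2 * (‖y‖ : ℂ)⁻¹ * (β i j y * Hs i j y) := by
    intro y
    simp only [solHat, hHs, β, Finset.sum_div, Finset.sum_mul, Finset.mul_sum]
    exact Finset.sum_congr rfl fun i _ => Finset.sum_congr rfl fun j _ => by ring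
  have hterm : ∀ i j, ∫ x, 𝓕 φ x * ∫ θ in (0 : ℝ)..(2 * Real.pi),
      β i j (perp (dir θ)) * ∫ t : ℝ, hf.component i j (x + t • dir θ) =
      ∫ y, 2 * (‖y‖ : ℂ)⁻¹ * (β i j y * Hs i j y) := by
    intro i j
    rw [integral_fourier_mul_rays φ _ (hbc i j) (fun θ => hβb i j _),
      ← integral_lines_eq (Hs i j) (hβc i j) (hβb i j) (hβh i j)]
    rfl
  have hint2 : ∀ i j, Integrable fun x => 𝓕 φ x * ∫ θ in (0 : ℝ)..(2 * Real.pi),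
      β i j (perp (dir θ)) * ∫ t : ℝ, hf.component i j (x + t • dir θ) := by
    intro i j
    obtain ⟨hc, C, hC⟩ := continuous_bounded_superposition (hf.component i j) (hbc i j)
      (fun θ => hβb i j _)
    exact (𝓕 φ).integrable.mul_bdd (c := C) hc.aestronglyMeasurable
      (Filter.Eventually.of_forall hC)
  simp only [hsum, normalOp_eq hf, hβd]
  refine ⟨integrable_finsetSum _ fun i _ => integrable_finsetSum _ fun j _ => hint i j, ?_⟩
  simp only [Finset.mul_sum]
  rw [integral_finsetSum _ fun i _ => integrable_finsetSum _ fun j _ => hint2 i j,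
    integral_finsetSum _ fun i _ => integrable_finsetSum _ fun j _ => hint i j]
  refine Finset.sum_congr rfl fun i _ => ?_
  rw [integral_finsetSum _ fun j _ => hint2 i j, integral_finsetSum _ fun j _ => hint i j]
  exact Finset.sum_congr rfl fun j _ => hterm i j

/-- The coordinate axes, where the symbol is singular, are null sets. -/
lemma coord_ne_zero_ae (a : Fin 2) : ∀ᵐ y : Plane, y a ≠ 0 := by
  have h := Measure.addHaar_submodule (volume : Measure Plane)
    (LinearMap.ker (EuclideanSpace.proj a : Plane →L[ℝ] ℝ).toLinearMap) (by
      intro h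
      rw [LinearMap.ker_eq_top] at h
      have := LinearMap.congr_fun h (EuclideanSpace.single a 1)
      simp at this)
  refine (measure_eq_zero_iff_ae_notMem.mp h).mono fun y hy => ?_
  simpa using hy

/-- The symbol maps the Fourier transform of the component `(1 ⋯ 1, 1 ⋯ 1)` of the normal operator
to that of the component `(m, n)` of the solenoidal part. -/
lemma symbol_mul_solHat (F : Idx k → Idx ℓ → 𝓢(Plane, ℂ)) (m : Idx k) (n : Idx ℓ) {y : Plane}
    (h0 : y 0 ≠ 0) (h1 : y 1 ≠ 0) :
    (1 / (4 * (Real.pi : ℂ))) * (-1) ^ numTwos m * symSqrtLaplacian y *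
      (symD 0 y ^ numTwos n * symD 1 y ^ numTwos m)⁻¹ *
      (symD 0 y ^ numTwos m * symD 1 y ^ numTwos n) *
      (2 * (‖y‖ : ℂ)⁻¹ * solHat F (fun _ => 0) (fun _ => 0) y) = solHat F m n y := by
  have h0' : (y 0 : ℂ) ≠ 0 := by exact_mod_cast h0
  have h1' : (y 1 : ℂ) ≠ 0 := by exact_mod_cast h1
  have hy : (‖y‖ : ℂ) ≠ 0 := by
    have : y ≠ 0 := fun h => h0 (by rw [h]; rfl)
    exact_mod_cast norm_ne_zero_iff.mpr this
  have hpi : (Real.pi : ℂ) ≠ 0 := by exact_mod_cast Real.pi_ne_zero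
  have hz : ∀ N : ℕ, numTwos (fun _ => 0 : Idx N) = 0 := fun N => by simp [numTwos]
  have hkey : mono (perp y) m n * ((y 0 : ℂ) ^ numTwos n * (y 1 : ℂ) ^ numTwos m) =
      (-1) ^ numTwos m * ((y 0 : ℂ) ^ numTwos m * (y 1 : ℂ) ^ numTwos n) *
        mono (perp y) (fun _ => 0 : Idx k) (fun _ => 0 : Idx ℓ) := by
    simp only [mono_eq_monoR, monoR]
    rw [prod_idx (fun a => (perp y a : ℂ)), prod_idx, prod_idx (fun a => (perp y a : ℂ)),
      prod_idx, hz, hz]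
    have hm := numTwos_le m
    have hn := numTwos_le n
    obtain ⟨a, ha⟩ := Nat.exists_eq_add_of_le hm
    obtain ⟨b, hb⟩ := Nat.exists_eq_add_of_le hn
    generalize numTwos m = M at *
    generalize numTwos n = N at *
    subst ha hb
    simp only [perp, Matrix.cons_val_zero, Matrix.cons_val_one, Nat.add_sub_cancel_left,
      Nat.sub_zero, pow_zero, mul_one, PiLp.toLp_apply, pow_add]
    push_cast
    have e1 : (-(y 1 : ℂ)) ^ M = (-1) ^ M * (y 1 : ℂ) ^ M := neg_pow _ _
    have e2 : (-(y 1 : ℂ)) ^ N = (-1) ^ N * (y 1 : ℂ) ^ N := neg_pow _ _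
    have e3 : (-(y 0 : ℂ)) ^ N = (-1) ^ N * (y 0 : ℂ) ^ N := neg_pow _ _
    have e4 : ((-1 : ℂ) ^ M) * (-1) ^ M = 1 := by rw [← mul_pow]; simp
    rw [e1, e2, e3]
    linear_combination (-(((y 0 : ℂ) ^ M * (y 1 : ℂ) ^ N) * (-(y 1 : ℂ)) ^ a *
      (y 1 : ℂ) ^ M * (-1) ^ N * (y 0 : ℂ) ^ N * (-(y 0 : ℂ)) ^ b)) * e4
  have hsy : (symD 0 y ^ numTwos n * symD 1 y ^ numTwos m)⁻¹ *
      (symD 0 y ^ numTwos m * symD 1 y ^ numTwos n) =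
      ((y 0 : ℂ) ^ numTwos n * (y 1 : ℂ) ^ numTwos m)⁻¹ *
      ((y 0 : ℂ) ^ numTwos m * (y 1 : ℂ) ^ numTwos n) := by
    simp only [symD]
    push_cast
    simp only [mul_pow]
    field_simp
  have hmul : mono (perp y) m n = (-1) ^ numTwos m *
      (((y 0 : ℂ) ^ numTwos n * (y 1 : ℂ) ^ numTwos m)⁻¹ *
      ((y 0 : ℂ) ^ numTwos m * (y 1 : ℂ) ^ numTwos n)) *
        mono (perp y) (fun _ => 0 : Idx k) (fun _ => 0 : Idx ℓ) := by
    have hne : (y 0 : ℂ) ^ numTwos n * (y 1 : ℂ) ^ numTwos m ≠ 0 := by positivity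
    rw [← mul_left_inj' hne, hkey]
    field_simp
  rw [mul_assoc _ (symD 0 y ^ numTwos n * symD 1 y ^ numTwos m)⁻¹, hsy]
  simp only [solHat, symSqrtLaplacian]
  rw [hmul]
  generalize ((y 0 : ℂ) ^ numTwos n * (y 1 : ℂ) ^ numTwos m)⁻¹ *
      ((y 0 : ℂ) ^ numTwos m * (y 1 : ℂ) ^ numTwos n) = Q
  generalize mono (perp y) (fun _ => 0 : Idx k) (fun _ => 0 : Idx ℓ) = P
  generalize (∑ i, ∑ j, F i j y * mono (perp y) i j) / (‖y‖ : ℂ) ^ (2 * (k + ℓ)) = E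
  push_cast
  field_simp
  ring

/-- The components of the solenoidal part are Fourier multipliers of the component
`(1 ⋯ 1, 1 ⋯ 1)` of the normal operator. -/
lemma isFourierMultiplier_normalOp {f : TField k ℓ} (hf : IsSmoothSymCompact f)
    (m : Idx k) (n : Idx ℓ) :
    IsFourierMultiplier
      (fun ξ => (1 / (4 * (Real.pi : ℂ))) * (-1) ^ numTwos m * symSqrtLaplacian ξ *
        (symD 0 ξ ^ numTwos n * symD 1 ξ ^ numTwos m)⁻¹ *
        (symD 0 ξ ^ numTwos m * symD 1 ξ ^ numTwos n))
      (normalOp f (fun _ => 0) (fun _ => 0))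
      (solPart (fun i j => 𝓕 (hf.component i j)) m n) := by
  set F : Idx k → Idx ℓ → 𝓢(Plane, ℂ) := fun i j => 𝓕 (hf.component i j)
  obtain ⟨S, hS⟩ : ∃ S : 𝓢'(Plane, ℂ), IsGivenBy S (normalOp f (fun _ => 0) (fun _ => 0)) := by
    have h : ∀ (i : Idx k) (j : Idx ℓ), ∃ C : ℝ, ∀ θ : ℝ,
        ‖mono (dir θ) (fun _ => 0 : Idx k) (fun _ => 0 : Idx ℓ) * mono (dir θ) i j‖ ≤ C := by
      refine fun i j => ⟨1 * 1, fun θ => ?_⟩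
      rw [norm_mul]
      have h1 := norm_mono_le (dir θ) (fun _ => 0 : Idx k) (fun _ => 0 : Idx ℓ)
      have h2 := norm_mono_le (dir θ) i j
      rw [norm_dir, one_pow] at h1 h2
      gcongr
    choose C1 hC1 using h
    have hcb := fun i j => continuous_bounded_superposition (hf.component i j)
      (((continuous_mono (fun _ => 0 : Idx k) (fun _ => 0 : Idx ℓ)).comp continuous_dir).mul
      ((continuous_mono i j).comp continuous_dir)) (hC1 i j)
    choose C hC using fun i j => (hcb i j).2
    have heq : normalOp f (fun _ => 0) (fun _ => 0) = fun x => ∑ i, ∑ j,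
        ∫ θ in (0 : ℝ)..(2 * Real.pi), (mono (dir θ) (fun _ => 0) (fun _ => 0) *
          mono (dir θ) i j) * ∫ t : ℝ, hf.component i j (x + t • dir θ) :=
      funext fun x => normalOp_eq hf _ _ x
    rw [heq]
    refine exists_isGivenBy (C := ∑ i, ∑ j, C i j) (continuous_finsetSum _ fun i _ =>
      continuous_finsetSum _ fun j _ => (hcb i j).1) fun x => ?_
    refine (norm_sum_le _ _).trans (Finset.sum_le_sum fun i _ => ?_)
    exact (norm_sum_le _ _).trans (Finset.sum_le_sum fun j _ => hC i j x)
  have hsol := rapidL1_solHat F m n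
  obtain ⟨T, hT⟩ : ∃ T : 𝓢'(Plane, ℂ), IsGivenBy T (solPart F m n) := by
    refine exists_isGivenBy (C := ∫ y, ‖solHat F m n y‖) hsol.contDiff.continuous fun x => ?_
    rw [solPart, Real.fourierInv_eq]
    refine (norm_integral_le_integral_norm _).trans_eq ?_
    simp [Circle.norm_smul]
  refine ⟨S, T, fun y => 2 * (‖y‖ : ℂ)⁻¹ * solHat F (fun _ => 0) (fun _ => 0) y, hS, hT,
    fun φ => ?_, fun φ => ?_⟩
  · have h := integral_fourier_mul_normalOp hf (fun _ => 0) (fun _ => 0) φ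
    refine ⟨h.1, ?_⟩
    rw [TemperedDistribution.fourier_apply, (hS (𝓕 φ)).2]
    exact h.2
  · have hae : (fun y => φ y * solHat F m n y) =ᵐ[volume] fun y => φ y *
        ((1 / (4 * (Real.pi : ℂ))) * (-1) ^ numTwos m * symSqrtLaplacian y *
        (symD 0 y ^ numTwos n * symD 1 y ^ numTwos m)⁻¹ *
        (symD 0 y ^ numTwos m * symD 1 y ^ numTwos n) *
        (2 * (‖y‖ : ℂ)⁻¹ * solHat F (fun _ => 0) (fun _ => 0) y)) := by
      filter_upwards [coord_ne_zero_ae 0, coord_ne_zero_ae 1] with y h0 h1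
      rw [symbol_mul_solHat F m n h0 h1]
    have hint : Integrable (fun y => φ y * solHat F m n y) := by
      have h := hsol.integrable.bdd_mul (c := SchwartzMap.seminorm ℂ 0 0 φ)
        φ.continuous.aestronglyMeasurable
        (Filter.Eventually.of_forall fun y => SchwartzMap.norm_le_seminorm ℂ φ y)
      exact h
    refine ⟨hint.congr hae, ?_⟩
    rw [TemperedDistribution.fourier_apply, (hT (𝓕 φ)).2, ← integral_congr_ae hae]
    exact integral_mul_fourierInv φ hsol.integrable

end Normal

end MixedRay

namespace MixedRay

/-! ### Divergence-free trace-free tensors over a commutative ring -/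

section DivFree

variable {R M : Type*} [CommRing R] [AddCommGroup M] [Module R M] {k ℓ : ℕ}

/-- Iteration of a proportionality between consecutive members of a sequence. -/
lemma pow_smul_eq_of_smul_succ {v : Fin 2 → R} {s : ℕ → M} {K : ℕ}
    (h : ∀ p < K, v 1 • s p = v 0 • s (p + 1)) (d p : ℕ) (hp : p + d ≤ K) :
    v 1 ^ d • s p = v 0 ^ d • s (p + d) := by
  induction d with
  | zero => simp
  | succ d ih =>
    rw [pow_succ', mul_smul, ih (by omega), smul_comm, h _ (by omega), smul_smul, ← pow_succ,
      add_assoc]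

lemma contr_add (v : Fin 2 → R) (S T : Idx k → Idx ℓ → M) :
    contr v (S + T) = contr v S + contr v T := by
  simp only [contr, Pi.add_apply, smul_add, Finset.sum_add_distrib]

/-- If a trace-free tensor is divergence-free and its contraction with the rotated derivatives
`v = (-X₂, X₁)` vanishes, then a power of `X₁² + X₂²` annihilates it: by the divergence
condition the components are proportional to those of `v ⊗ ⋯ ⊗ v ⊗ v^⊥ ⊗ ⋯ ⊗ v^⊥`. -/
lemma pow_smul_eq_zero_of_contr_eq_zero {X : Fin 2 → R} (s : ℕ → M)
    (hdiv : ∀ (i : Idx k) (j : Idx ℓ),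
      ∑ a, X a • traceFreeOf s (Fin.cons a i : Idx (k + 1)) j = 0)
    (hcontr : contr ![-X 1, X 0] (traceFreeOf s : Idx (k + 1) → Idx ℓ → M) = 0)
    (m : Idx (k + 1)) (n : Idx ℓ) :
    (X 0 ^ 2 + X 1 ^ 2) ^ (k + 1 + ℓ) • traceFreeOf s m n = 0 := by
  set v : Fin 2 → R := ![-X 1, X 0]
  have hv0 : v 0 = -X 1 := rfl
  have hv1 : v 1 = X 0 := rfl
  -- the divergence condition, tested on index tuples with prescribed numbers of twos
  have hs : ∀ p < k + 1 + ℓ, v 1 • s p = v 0 • s (p + 1) := by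
    intro p hp
    have h := hdiv (stdIdx k (p - ℓ)) (stdIdx ℓ (ℓ - p))
    simp only [Fin.sum_univ_two, traceFreeOf, numTwos_cons,
      numTwos_stdIdx (show p - ℓ ≤ k by omega), numTwos_stdIdx (show ℓ - p ≤ ℓ by omega),
      Fin.val_zero, Fin.val_one] at h
    rw [show p - ℓ + 0 + (ℓ - (ℓ - p)) = p by omega,
      show p - ℓ + 1 + (ℓ - (ℓ - p)) = p + 1 by omega, smul_comm, smul_comm (X 1), ← smul_add] at h
    have h' := congrArg (((-1 : ℤ) ^ (ℓ - (ℓ - p))) • ·) h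
    simp only [smul_smul, ← mul_pow, smul_zero] at h'
    rw [hv0, hv1, neg_smul]
    exact eq_neg_of_add_eq_zero_left (by simpa using h')
  have hswap : ∀ p q, p ≤ k + 1 + ℓ → q ≤ k + 1 + ℓ →
      (v 0 ^ (k + 1 + ℓ - p) * v 1 ^ p) • s q = (v 0 ^ (k + 1 + ℓ - q) * v 1 ^ q) • s p := by
    have key : ∀ p d, p + d ≤ k + 1 + ℓ →
        (v 0 ^ (k + 1 + ℓ - p) * v 1 ^ p) • s (p + d) =
          (v 0 ^ (k + 1 + ℓ - (p + d)) * v 1 ^ (p + d)) • s p := by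
      intro p d hd
      rw [show k + 1 + ℓ - p = (k + 1 + ℓ - (p + d)) + d by omega, pow_add, pow_add (v 1),
        mul_right_comm, mul_smul _ (v 0 ^ d), ← pow_smul_eq_of_smul_succ hs d p hd, smul_smul,
        mul_assoc]
    intro p q hp hq
    rcases le_total p q with h | h
    · obtain ⟨d, rfl⟩ := Nat.exists_eq_add_of_le h
      exact key p d hq
    · obtain ⟨d, rfl⟩ := Nat.exists_eq_add_of_le h
      exact (key q d hp).symm
  have hmono : ∀ (i : Idx (k + 1)) (j : Idx ℓ),
      monoR v m n • traceFreeOf s i j = monoR v i j • traceFreeOf s m n := by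
    intro i j
    have h1 := numTwos_le i
    have h2 := numTwos_le m
    simp only [monoR_eq, traceFreeOf, ← Int.cast_smul_eq_zsmul R, smul_smul]
    push_cast
    rw [mul_right_comm, mul_smul, hswap _ _ (by omega) (by omega), smul_smul]
    congr 1
    ring
  -- `X₁² + X₂² = ⟨v, v⟩`, and its power is the contraction of `monoR v` with itself
  have hsq : (X 0 ^ 2 + X 1 ^ 2) ^ (k + 1 + ℓ) =
      ∑ i : Idx (k + 1), ∑ j : Idx ℓ, monoR v i j * monoR v i j := by
    rw [sum_monoR_mul_monoR, hv0, hv1]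
    congr 1
    ring
  rw [hsq]
  simp only [Finset.sum_smul, mul_smul]
  simp only [← hmono]
  have := congrArg (monoR v m n • ·) hcontr
  simp only [contr, Finset.smul_sum, smul_zero] at this
  rw [← this]
  exact Finset.sum_congr rfl fun i _ => Finset.sum_congr rfl fun j _ => smul_comm _ _ _

/-- Contraction with `v ⊗ ⋯ ⊗ v ⊗ v^⊥ ⊗ ⋯ ⊗ v^⊥`, where `v = (-X₂, X₁)`, annihilates the
symmetrization of `X ⊗ T`, because `v₁ X₁ + v₂ X₂ = 0`. -/
lemma contr_symmetrize_smul (X : Fin 2 → R) (T : Idx k → Idx ℓ → M) :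
    contr ![-X 1, X 0] (fun (i : Idx (k + 1)) (j : Idx ℓ) =>
      ∑ π : Equiv.Perm (Fin (k + 1)), X (i (π 0)) • T (fun a => i (π a.succ)) j) = 0 := by
  rw [contr_symmetrize _ fun c i j => X c • T i j]
  have h (c : Fin 2) : contr ![-X 1, X 0] (fun i j => X c • T i j) =
      X c • contr ![-X 1, X 0] T := by
    simp only [contr, Finset.smul_sum]
    exact Finset.sum_congr rfl fun i _ => Finset.sum_congr rfl fun j _ => smul_comm _ _ _
  simp only [h, smul_smul, ← Finset.sum_smul]
  simp [Fin.sum_univ_two, mul_comm]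

end DivFree

/-! ### Differential operators on smooth functions -/

section SmoothFunctions

/-- The smooth functions on the plane, as a complex vector space. -/
def smoothSubmodule : Submodule ℂ (Plane → ℂ) where
  carrier := {h | ContDiff ℝ ∞ h}
  add_mem' {g h} hg hh := by
    rw [Set.mem_ofPred_eq] at hg hh ⊢
    exact hg.add hh
  zero_mem' := by
    rw [Set.mem_ofPred_eq]
    exact contDiff_zero_fun
  smul_mem' c h hh := by
    rw [Set.mem_ofPred_eq] at hh ⊢
    exact contDiff_const.smul hh

/-- The type of smooth functions on the plane, on which the algebra of differential operators
acts. -/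
def SmoothFun : Type := smoothSubmodule

noncomputable instance : AddCommGroup SmoothFun := inferInstanceAs (AddCommGroup smoothSubmodule)

noncomputable instance : Module ℂ SmoothFun := inferInstanceAs (Module ℂ smoothSubmodule)

/-- The inclusion of the smooth functions into all functions. -/
noncomputable def SmoothFun.val : SmoothFun →ₗ[ℂ] (Plane → ℂ) := smoothSubmodule.subtype

lemma SmoothFun.contDiff (h : SmoothFun) : ContDiff ℝ ∞ h.val := h.2

lemma SmoothFun.ext {g h : SmoothFun} (hgh : g.val = h.val) : g = h := Subtype.ext hgh

/-- A smooth function as an element of `SmoothFun`. -/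
def SmoothFun.mk (h : Plane → ℂ) (hh : ContDiff ℝ ∞ h) : SmoothFun := ⟨h, hh⟩

lemma contDiff_pd {h : Plane → ℂ} (hh : ContDiff ℝ ∞ h) (a : Fin 2) : ContDiff ℝ ∞ (pd a h) :=
  (hh.fderiv_right (m := ∞) (by simp)).clm_apply contDiff_const

lemma pd_add {g h : Plane → ℂ} (hg : ContDiff ℝ ∞ g) (hh : ContDiff ℝ ∞ h) (a : Fin 2) :
    pd a (g + h) = pd a g + pd a h := by
  funext x
  simp only [pd, Pi.add_apply]
  rw [fderiv_add (hg.differentiable (by simp) x) (hh.differentiable (by simp) x)]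
  rfl

lemma pd_smul {h : Plane → ℂ} (hh : ContDiff ℝ ∞ h) (c : ℂ) (a : Fin 2) :
    pd a (c • h) = c • pd a h := by
  funext x
  simp only [pd, Pi.smul_apply]
  rw [fderiv_const_smul (hh.differentiable (by simp) x)]
  rfl

lemma pd_pd_eq {h : Plane → ℂ} (hh : ContDiff ℝ ∞ h) (c d : Fin 2) (x : Plane) :
    pd c (pd d h) x =
      fderiv ℝ (fderiv ℝ h) x (EuclideanSpace.single c 1) (EuclideanSpace.single d 1) := by
  have hd : DifferentiableAt ℝ (fderiv ℝ h) x :=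
    (hh.fderiv_right (m := ∞) (by simp)).differentiable (by simp) x
  unfold pd
  rw [fderiv_clm_apply hd (differentiableAt_const _)]
  simp

lemma pd_comm {h : Plane → ℂ} (hh : ContDiff ℝ ∞ h) (a b : Fin 2) :
    pd a (pd b h) = pd b (pd a h) := by
  funext x
  rw [pd_pd_eq hh, pd_pd_eq hh]
  exact (hh.contDiffAt.isSymmSndFDerivAt
    (by simpa using (ENat.LEInfty.out : (2 : WithTop ℕ∞) ≤ ∞))) _ _

/-- The partial derivative as an operator on smooth functions. -/
noncomputable def pdLin (a : Fin 2) : Module.End ℂ SmoothFun where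
  toFun h := .mk (pd a h.val) (contDiff_pd h.contDiff a)
  map_add' g h := SmoothFun.ext (pd_add g.contDiff h.contDiff a)
  map_smul' c h := SmoothFun.ext (pd_smul h.contDiff c a)

lemma pdLin_mul_comm (a b : Fin 2) : pdLin a * pdLin b = pdLin b * pdLin a :=
  LinearMap.ext fun h => SmoothFun.ext (pd_comm h.contDiff a b)

open scoped IsMulCommutative

/-- The commutative algebra of constant coefficient differential operators. -/
noncomputable def diffOp : Subalgebra ℂ (Module.End ℂ SmoothFun) :=
  Algebra.adjoin ℂ (Set.range pdLin)

instance : IsMulCommutative diffOp :=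
  Algebra.isMulCommutative_adjoin ℂ <| by
    rintro _ ⟨a, rfl⟩ _ ⟨b, rfl⟩
    exact pdLin_mul_comm a b

/-- The partial derivative as an element of the algebra of differential operators. -/
noncomputable def pdOp (a : Fin 2) : diffOp := ⟨pdLin a, Algebra.subset_adjoin ⟨a, rfl⟩⟩

/-- The Laplace operator in coordinates. -/
noncomputable def lap (h : Plane → ℂ) : Plane → ℂ := pd 0 (pd 0 h) + pd 1 (pd 1 h)

lemma contDiff_lap {h : Plane → ℂ} (hh : ContDiff ℝ ∞ h) : ContDiff ℝ ∞ (lap h) :=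
  (contDiff_pd (contDiff_pd hh 0) 0).add (contDiff_pd (contDiff_pd hh 1) 1)

lemma val_laplacian_pow_smul (K : ℕ) (h : SmoothFun) :
    ((pdOp 0 ^ 2 + pdOp 1 ^ 2) ^ K • h).val = lap^[K] h.val := by
  induction K generalizing h with
  | zero => rw [pow_zero, one_smul]; rfl
  | succ K ih =>
    rw [pow_succ, mul_smul, ih, Function.iterate_succ_apply]
    congr 1

lemma contr_smul {k ℓ : ℕ} (v : Fin 2 → diffOp) (c : ℂ) (T : Idx k → Idx ℓ → SmoothFun) :
    contr v (fun i j => c • T i j) = c • contr v T := by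
  simp only [contr, Finset.smul_sum]
  exact Finset.sum_congr rfl fun i _ => Finset.sum_congr rfl fun j _ => smul_comm _ _ _

/-- The field `T` as an array of elements of the space of smooth functions. -/
def IsSmoothSym.lift {k ℓ : ℕ} {T : TField k ℓ} (hT : IsSmoothSym T) (i : Idx k) (j : Idx ℓ) :
    SmoothFun := .mk (T i j) (hT.smooth i j)

/-- The rotated derivatives `(-∂₂, ∂₁)`. -/
noncomputable def rotOp : Fin 2 → diffOp := ![-pdOp 1, pdOp 0]

lemma contr_rotOp_dPrime {k ℓ : ℕ} {U : TField k ℓ} (hU : IsSmoothSym U)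
    (T : Idx (k + 1) → Idx ℓ → SmoothFun) (hT : ∀ i j, (T i j).val = dPrime U i j) :
    contr rotOp T = 0 := by
  have h : T = fun i j => (1 / ((k + 1).factorial : ℂ)) •
      ∑ π : Equiv.Perm (Fin (k + 1)), pdOp (i (π 0)) • hU.lift (fun a => i (π a.succ)) j := by
    funext i j
    refine SmoothFun.ext (funext fun x => ?_)
    rw [hT, map_smul, Pi.smul_apply, map_sum, Finset.sum_apply]
    rfl
  rw [h, contr_smul]
  unfold rotOp
  rw [contr_symmetrize_smul pdOp hU.lift, smul_zero]

lemma contr_rotOp_lam {k ℓ : ℕ} {W : TField k ℓ} (hW : IsSmoothSym W)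
    (T : Idx (k + 1) → Idx (ℓ + 1) → SmoothFun)
    (hT : ∀ i j, (T i j).val = lam W i j) :
    contr rotOp T = 0 := by
  have h : T = fun i j => ((1 / ((k + 1).factorial : ℂ)) * (1 / ((ℓ + 1).factorial : ℂ))) •
      ∑ π : Equiv.Perm (Fin (k + 1)), ∑ ρ : Equiv.Perm (Fin (ℓ + 1)),
      if i (π 0) = j (ρ 0) then hW.lift (fun a => i (π a.succ)) (fun b => j (ρ b.succ)) else 0 := by
    funext i j
    refine SmoothFun.ext (funext fun x => ?_)
    rw [hT, map_smul, Pi.smul_apply, map_sum, Finset.sum_apply]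
    simp only [map_sum, Finset.sum_apply, lam, smul_eq_mul]
    congr 1
    refine Finset.sum_congr rfl fun π _ => Finset.sum_congr rfl fun ρ _ => ?_
    split_ifs <;> rfl
  rw [h, contr_smul, contr_lam, smul_zero]

/-- The components of a solenoidal trace-free field that is annihilated by the contraction with
`(-∂₂, ∂₁)` are polyharmonic. -/
lemma lap_iterate_eq_zero {k ℓ : ℕ} {S : TField (k + 1) ℓ} (hS : IsSmoothSym S)
    (hd : IsDivFree S) (ht : IsTraceFree S) (hc : contr rotOp hS.lift = 0)
    (m : Idx (k + 1)) (n : Idx ℓ) : lap^[k + 1 + ℓ] (S m n) = 0 := by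
  obtain ⟨s, hs⟩ := exists_eq_traceFreeOf hS.lift
    (fun π i j => SmoothFun.ext (hS.symm_left π i j))
    (fun π i j => SmoothFun.ext (hS.symm_right π i j)) (by
      intro k' ℓ' hk hl i j
      obtain rfl : k' = k := by omega
      subst hl
      refine SmoothFun.ext ?_
      funext x
      rw [map_sum, Finset.sum_apply]
      exact congrFun (congrFun (congrFun (show trace S = 0 from ht) i) j) x)
  have h := pow_smul_eq_zero_of_contr_eq_zero (X := pdOp) s (fun i j => by
      rw [← hs]
      refine SmoothFun.ext (funext fun x => ?_)
      rw [map_sum, Finset.sum_apply]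
      exact congrFun (congrFun (congrFun (show divPrime S = 0 from hd) i) j) x)
    (by rw [← hs]; exact hc) m n
  rw [← hs] at h
  have h' := congrArg SmoothFun.val h
  rw [val_laplacian_pow_smul] at h'
  exact h'

end SmoothFunctions

end MixedRay

namespace MixedRay

/-! ### Polyharmonic functions that vanish at infinity -/

section Liouville

open MeasureTheory Filter Topology

lemma isBounded_range_of_tendsto {h : Plane → ℂ} (hc : Continuous h)
    (h0 : Tendsto h (cocompact Plane) (𝓝 0)) : Bornology.IsBounded (Set.range h) :=
  ZeroAtInftyContinuousMap.isBounded_range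
    (⟨⟨h, hc⟩, h0⟩ : ZeroAtInftyContinuousMap Plane ℂ)

/-- Liouville's theorem, transferred from the complex plane. -/
lemma eq_zero_of_lap_eq_zero {h : Plane → ℂ} (hh : ContDiff ℝ ∞ h)
    (h0 : Tendsto h (cocompact Plane) (𝓝 0)) (hl : lap h = 0) : h = 0 := by
  let e : ℂ ≃ₗᵢ[ℝ] Plane := Complex.orthonormalBasisOneI.repr
  have he1 : e 1 = EuclideanSpace.single 0 1 := by
    have := Complex.orthonormalBasisOneI.repr_self 0
    simpa using this
  have heI : e Complex.I = EuclideanSpace.single 1 1 := by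
    have := Complex.orthonormalBasisOneI.repr_self 1
    simpa using this
  let g : ℂ →L[ℝ] Plane := e.toContinuousLinearEquiv.toContinuousLinearMap
  have hharm : InnerProductSpace.HarmonicOnNhd (h ∘ g) Set.univ := by
    intro z _
    refine ⟨((hh.of_le (m := 2) (ENat.LEInfty.out)).comp g.contDiff).contDiffAt,
      Eventually.of_forall fun y => ?_⟩
    rw [InnerProductSpace.laplacian_eq_iteratedFDeriv_complexPlane]
    simp only
    rw [g.iteratedFDeriv_comp_right (hh.of_le (m := 2) ENat.LEInfty.out) y le_rfl]
    simp only [ContinuousMultilinearMap.compContinuousLinearMap_apply, iteratedFDeriv_two_apply]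
    have h1 : g 1 = EuclideanSpace.single 0 1 := he1
    have hI : g Complex.I = EuclideanSpace.single 1 1 := heI
    simp only [Matrix.cons_val_zero, Matrix.cons_val_one, h1, hI]
    rw [← pd_pd_eq hh, ← pd_pd_eq hh]
    exact congrFun hl (g y)
  have hconst := InnerProductSpace.bounded_harmonic_on_complex_plane_is_constant (h ∘ g) hharm
    ((isBounded_range_of_tendsto hh.continuous h0).subset (Set.range_comp_subset_range g h))
  have hconst' : ∀ x, h x = h 0 := by
    intro x
    have := hconst (e.symm x) (e.symm 0)
    have hx (y : Plane) : g (e.symm y) = y := e.apply_symm_apply y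
    simpa only [Function.comp_apply, hx] using this
  have hlim : Tendsto h (cocompact Plane) (𝓝 (h 0)) :=
    tendsto_const_nhds.congr fun x => (hconst' x).symm
  funext x
  rw [hconst' x]
  exact tendsto_nhds_unique hlim h0

/-- Convolution of complex-valued functions on the plane. -/
noncomputable def conv (h ρ : Plane → ℂ) : Plane → ℂ :=
  convolution h ρ (ContinuousLinearMap.mul ℝ ℂ) volume

lemma conv_apply (h ρ : Plane → ℂ) (x : Plane) : conv h ρ x = ∫ t, h t * ρ (x - t) := rfl

lemma hasCompactSupport_pd {ρ : Plane → ℂ} (hρ : HasCompactSupport ρ) (a : Fin 2) :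
    HasCompactSupport (pd a ρ) :=
  hρ.fderiv_apply ℝ _

lemma hasCompactSupport_lap {ρ : Plane → ℂ} (hρ : HasCompactSupport ρ) :
    HasCompactSupport (lap ρ) :=
  (hasCompactSupport_pd (hasCompactSupport_pd hρ 0) 0).add
    (hasCompactSupport_pd (hasCompactSupport_pd hρ 1) 1)

lemma contDiff_conv {h ρ : Plane → ℂ} (hh : Continuous h) (hρ : ContDiff ℝ ∞ ρ)
    (hs : HasCompactSupport ρ) : ContDiff ℝ ∞ (conv h ρ) :=
  hs.contDiff_convolution_right _ hh.locallyIntegrable hρ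

lemma pd_conv {h ρ : Plane → ℂ} (hh : Continuous h) (hρ : ContDiff ℝ ∞ ρ)
    (hs : HasCompactSupport ρ) (a : Fin 2) : pd a (conv h ρ) = conv h (pd a ρ) := by
  funext x
  have hρ1 : ContDiff ℝ 1 ρ := hρ.of_le ENat.LEInfty.out
  unfold pd conv
  rw [(hs.hasFDerivAt_convolution_right (ContinuousLinearMap.mul ℝ ℂ)
    hh.locallyIntegrable hρ1 x).fderiv,
    convolution_precompR_apply _ hh.locallyIntegrable (hs.fderiv ℝ)
      (hρ1.continuous_fderiv one_ne_zero)]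

/-- Integration by parts moves a derivative between the factors of a convolution. -/
lemma conv_pd {h ρ : Plane → ℂ} (hh : ContDiff ℝ ∞ h) (hρ : ContDiff ℝ ∞ ρ)
    (hs : HasCompactSupport ρ) (a : Fin 2) : conv h (pd a ρ) = conv (pd a h) ρ := by
  funext x
  simp only [conv_apply]
  set τ : Plane → ℂ := fun t => ρ (x - t)
  have hτd : ContDiff ℝ ∞ τ := hρ.comp (contDiff_const.sub contDiff_id)
  have hτs : HasCompactSupport τ := hs.comp_homeomorph (Homeomorph.subLeft x)
  have hpd (t : Plane) : fderiv ℝ τ t (EuclideanSpace.single a 1) = -pd a ρ (x - t) := by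
    have h1 : HasFDerivAt τ ((fderiv ℝ ρ (x - t)).comp (-ContinuousLinearMap.id ℝ Plane)) t :=
      HasFDerivAt.comp t ((hρ.differentiable (by simp) (x - t)).hasFDerivAt)
        ((hasFDerivAt_id t).const_sub x)
    rw [h1.fderiv]
    simp [pd]
  have hcd : Continuous fun t => fderiv ℝ τ t (EuclideanSpace.single a 1) :=
    (contDiff_pd hτd a).continuous
  have hch : Continuous fun t => fderiv ℝ h t (EuclideanSpace.single a 1) :=
    (contDiff_pd hh a).continuous
  have h := integral_mul_fderiv_eq_neg_fderiv_mul_of_integrable (𝕜 := ℂ) (μ := volume)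
    (f := h) (g := τ) (v := EuclideanSpace.single a 1)
    ((hch.mul hτd.continuous).integrable_of_hasCompactSupport hτs.mul_left)
    ((hh.continuous.mul hcd).integrable_of_hasCompactSupport (hasCompactSupport_pd hτs a).mul_left)
    ((hh.continuous.mul hτd.continuous).integrable_of_hasCompactSupport hτs.mul_left)
    (fun t _ => hh.differentiable (by simp) t) (fun t _ => hτd.differentiable (by simp) t)
  simp only [hpd, mul_neg, integral_neg, neg_inj] at h
  exact h

lemma conv_add_left {g h ρ : Plane → ℂ} (hg : Continuous g) (hh : Continuous h)
    (hρ : Continuous ρ) (hs : HasCompactSupport ρ) : conv (g + h) ρ = conv g ρ + conv h ρ := by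
  funext x
  have hi {u : Plane → ℂ} (hu : Continuous u) : Integrable fun t => u t * ρ (x - t) :=
    (hu.mul (hρ.comp (continuous_const.sub continuous_id))).integrable_of_hasCompactSupport
      (hs.comp_homeomorph (Homeomorph.subLeft x)).mul_left
  simp only [Pi.add_apply, conv_apply, add_mul]
  exact integral_add (hi hg) (hi hh)

lemma lap_conv {h ρ : Plane → ℂ} (hh : ContDiff ℝ ∞ h) (hρ : ContDiff ℝ ∞ ρ)
    (hs : HasCompactSupport ρ) : lap (conv h ρ) = conv (lap h) ρ := by
  have h1 (a : Fin 2) : pd a (pd a (conv h ρ)) = conv (pd a (pd a h)) ρ := by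
    rw [pd_conv hh.continuous hρ hs, conv_pd hh hρ hs,
      pd_conv (contDiff_pd hh a).continuous hρ hs, conv_pd (contDiff_pd hh a) hρ hs]
  rw [lap, h1, h1, lap, conv_add_left (contDiff_pd (contDiff_pd hh 0) 0).continuous
    (contDiff_pd (contDiff_pd hh 1) 1).continuous hρ.continuous hs]

/-- The Laplacian of a mollified function is a mollification of the function itself, so that it
inherits the behaviour at infinity. -/
lemma lap_conv_right {h ρ : Plane → ℂ} (hh : ContDiff ℝ ∞ h) (hρ : ContDiff ℝ ∞ ρ)
    (hs : HasCompactSupport ρ) : lap (conv h ρ) = conv h (lap ρ) := by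
  have h1 (a : Fin 2) : pd a (pd a (conv h ρ)) = conv h (pd a (pd a ρ)) := by
    rw [pd_conv hh.continuous hρ hs, pd_conv hh.continuous (contDiff_pd hρ a)
      (hasCompactSupport_pd hs a)]
  rw [lap, h1, h1, lap]
  funext x
  have hi {u : Plane → ℂ} (hu : Continuous u) (hus : HasCompactSupport u) :
      Integrable fun t => h t * u (x - t) :=
    (hh.continuous.mul
      (hu.comp (continuous_const.sub continuous_id))).integrable_of_hasCompactSupport
      (hus.comp_homeomorph (Homeomorph.subLeft x)).mul_left
  simp only [Pi.add_apply, conv_apply, mul_add]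
  exact (integral_add
    (hi (contDiff_pd (contDiff_pd hρ 0) 0).continuous
      (hasCompactSupport_pd (hasCompactSupport_pd hs 0) 0))
    (hi (contDiff_pd (contDiff_pd hρ 1) 1).continuous
      (hasCompactSupport_pd (hasCompactSupport_pd hs 1) 1))).symm

lemma tendsto_conv {h ρ : Plane → ℂ} (hh : Continuous h)
    (h0 : Tendsto h (cocompact Plane) (𝓝 0)) (hρ : Continuous ρ) (hs : HasCompactSupport ρ) :
    Tendsto (conv h ρ) (cocompact Plane) (𝓝 0) := by
  obtain ⟨C, hC⟩ := (isBounded_range_of_tendsto hh h0).exists_norm_le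
  -- dominated convergence needs a countably generated filter
  have hgen : (cocompact Plane).IsCountablyGenerated := by
    rw [← Metric.cobounded_eq_cocompact, ← comap_norm_atTop]
    infer_instance
  have heq : conv h ρ = fun x => ∫ t, h (x - t) * ρ t := by
    funext x
    rw [conv_apply, ← integral_sub_left_eq_self _ volume x]
    simp
  rw [heq, ← integral_zero Plane ℂ (μ := volume)]
  refine tendsto_integral_filter_of_dominated_convergence (fun t => C * ‖ρ t‖)
    (Eventually.of_forall fun x =>
      ((hh.comp (continuous_const.sub continuous_id)).mul hρ).aestronglyMeasurable)
    (Eventually.of_forall fun x => Eventually.of_forall fun t => ?_)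
    ((hρ.norm.integrable_of_hasCompactSupport hs.norm).const_mul C)
    (Eventually.of_forall fun t => ?_)
  · rw [norm_mul]
    exact mul_le_mul_of_nonneg_right (hC _ ⟨_, rfl⟩) (norm_nonneg _)
  · have h1 := (h0.comp (Homeomorph.subRight t).isClosedEmbedding.tendsto_cocompact).mul_const (ρ t)
    simpa using h1

/-- A polyharmonic function on the plane that tends to zero at infinity vanishes: mollified, it
has iterated Laplacians that all tend to zero, so that Liouville's theorem applies repeatedly. -/
lemma eq_zero_of_lap_iterate_eq_zero {h : Plane → ℂ} (hh : ContDiff ℝ ∞ h)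
    (h0 : Tendsto h (cocompact Plane) (𝓝 0)) {K : ℕ} (hl : lap^[K] h = 0) : h = 0 := by
  have key : ∀ ρ : Plane → ℂ, ContDiff ℝ ∞ ρ → HasCompactSupport ρ → conv h ρ = 0 := by
    intro ρ hρ hs
    have hleft : ∀ (K : ℕ) (u : Plane → ℂ), ContDiff ℝ ∞ u →
        lap^[K] (conv u ρ) = conv (lap^[K] u) ρ := by
      intro K
      induction K with
      | zero => simp
      | succ K ih =>
        intro u hu
        rw [Function.iterate_succ_apply, lap_conv hu hρ hs, ih _ (contDiff_lap hu),
          Function.iterate_succ_apply]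
    have hmain : ∀ (K : ℕ) (τ : Plane → ℂ), ContDiff ℝ ∞ τ → HasCompactSupport τ →
        lap^[K] (conv h τ) = 0 → conv h τ = 0 := by
      intro K
      induction K with
      | zero => simp
      | succ K ih =>
        intro τ hτ hτs hK
        refine eq_zero_of_lap_eq_zero (contDiff_conv hh.continuous hτ hτs)
          (tendsto_conv hh.continuous h0 hτ.continuous hτs) ?_
        rw [lap_conv_right hh hτ hτs]
        refine ih _ (contDiff_lap hτ) (hasCompactSupport_lap hτs) ?_
        rwa [← lap_conv_right hh hτ hτs, ← Function.iterate_succ_apply]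
    refine hmain K ρ hρ hs ?_
    rw [hleft K h hh, hl]
    funext x
    simp [conv_apply]
  have hae := ae_eq_zero_of_integral_contDiff_smul_eq_zero (μ := volume)
    hh.continuous.locallyIntegrable fun g hg hgs => by
      have h1 := congrFun (key (fun y => (g (-y) : ℂ))
        (Complex.ofRealCLM.contDiff.comp (hg.comp contDiff_neg))
        ((hgs.comp_homeomorph (Homeomorph.neg Plane)).comp_left Complex.ofReal_zero)) 0
      simpa [conv_apply, mul_comm] using h1
  exact (Continuous.ae_eq_iff_eq volume hh.continuous continuous_zero).mp hae

end Liouville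

/-! ### Uniqueness of the solenoidal part -/

section Uniqueness

open scoped IsMulCommutative

lemma dPrime_sub {k ℓ : ℕ} {u u' : TField k ℓ} (hu : IsSmoothSym u) (hu' : IsSmoothSym u') :
    dPrime (u - u') = dPrime u - dPrime u' := by
  funext i j x
  simp only [dPrime, Pi.sub_apply, ← mul_sub, ← Finset.sum_sub_distrib]
  congr 1
  refine Finset.sum_congr rfl fun π _ => ?_
  simp only [pd]
  rw [fderiv_sub ((hu.smooth _ _).differentiable (by simp) x)
    ((hu'.smooth _ _).differentiable (by simp) x)]
  rfl

lemma lam_sub {k ℓ : ℕ} (w w' : TField k ℓ) : lam (w - w') = lam w - lam w' := by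
  funext i j x
  simp only [lam, Pi.sub_apply, ← mul_sub, ← Finset.sum_sub_distrib]
  congr 1
  refine Finset.sum_congr rfl fun π _ => Finset.sum_congr rfl fun ρ _ => ?_
  split_ifs <;> simp

lemma IsSmoothSym.sub {k ℓ : ℕ} {f g : TField k ℓ} (hf : IsSmoothSym f) (hg : IsSmoothSym g) :
    IsSmoothSym (f - g) where
  smooth i j := (hf.smooth i j).sub (hg.smooth i j)
  symm_left π i j := by simp only [Pi.sub_apply, hf.symm_left, hg.symm_left]
  symm_right π i j := by simp only [Pi.sub_apply, hf.symm_right, hg.symm_right]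

lemma IsDivFree.sub {k ℓ : ℕ} {f g : TField k ℓ} (hfs : IsSmoothSym f) (hgs : IsSmoothSym g)
    (hf : IsDivFree f) (hg : IsDivFree g) : IsDivFree (f - g) := by
  cases k with
  | zero => trivial
  | succ k =>
    have hf' : divPrime f = 0 := hf
    have hg' : divPrime g = 0 := hg
    change divPrime (f - g) = 0
    rw [← sub_zero (0 : TField k ℓ)]
    nth_rewrite 1 [← hf']
    rw [← hg']
    funext i j x
    simp only [divPrime, Pi.sub_apply, ← Finset.sum_sub_distrib, pd]
    refine Finset.sum_congr rfl fun a _ => ?_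
    rw [fderiv_sub ((hfs.smooth _ _).differentiable (by simp) x)
      ((hgs.smooth _ _).differentiable (by simp) x)]
    rfl

lemma IsTraceFree.sub {k ℓ : ℕ} {f g : TField k ℓ} (hf : IsTraceFree f) (hg : IsTraceFree g) :
    IsTraceFree (f - g) := by
  rcases k with _ | k
  · trivial
  rcases ℓ with _ | ℓ
  · trivial
  have hf' : trace f = 0 := hf
  have hg' : trace g = 0 := hg
  change trace (f - g) = 0
  rw [← sub_zero (0 : TField k ℓ)]
  nth_rewrite 1 [← hf']
  rw [← hg']
  funext i j x
  simp only [trace, Pi.sub_apply, ← Finset.sum_sub_distrib]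

/-- A field has at most one solenoidal part: the difference of two is solenoidal, trace-free, and
of the form `d' u + λ w`; hence it is polyharmonic and tends to zero at infinity. -/
lemma IsSolenoidalPart.unique {k ℓ : ℕ} {f fs fs' : TField k ℓ} (h : IsSolenoidalPart f fs)
    (h' : IsSolenoidalPart f fs') : fs' = fs := by
  obtain ⟨hs, hd, ht, hv, p, q, hp, hq, hf⟩ := h
  obtain ⟨hs', hd', ht', hv', p', q', hp', hq', hf'⟩ := h'
  rcases k with _ | k
  · have e1 : p = 0 := hp
    have e2 : q = 0 := hq
    have e3 : p' = 0 := hp'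
    have e4 : q' = 0 := hq'
    subst e1 e2 e3 e4
    simpa using hf'.symm.trans hf
  have hS := hs.sub hs'
  have hfs : fs - fs' = (p' - p) + (q' - q) := by
    have := hf.symm.trans hf'
    linear_combination (exp := 1) this
  suffices hc : contr rotOp hS.lift = 0 by
    funext m n
    have h1 := eq_zero_of_lap_iterate_eq_zero (hS.smooth m n)
      (by have h2 := (hv m n).sub (hv' m n); rwa [sub_zero] at h2)
      (lap_iterate_eq_zero hS (hd.sub hs hs' hd') (ht.sub ht') hc m n)
    exact (sub_eq_zero.mp h1).symm
  obtain ⟨u, hu, -, -, rfl⟩ := hp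
  obtain ⟨u', hu', -, -, rfl⟩ := hp'
  rw [← dPrime_sub hu' hu] at hfs
  have hU := hu'.sub hu
  rcases ℓ with _ | ℓ
  · have e2 : q = 0 := hq
    have e4 : q' = 0 := hq'
    subst e2 e4
    refine contr_rotOp_dPrime hU _ fun i j => ?_
    change (fs - fs') i j = _
    rw [hfs]
    simp
  obtain ⟨w, hw, rfl⟩ := hq
  obtain ⟨w', hw', rfl⟩ := hq'
  rw [← lam_sub] at hfs
  have hW := hw'.sub hw
  have hD := isSmoothSym_dPrime hU
  have hL : IsSmoothSym (lam (w' - w)) := by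
    have : lam (w' - w) = (fs - fs') - dPrime (u' - u) := by rw [hfs]; abel
    rw [this]
    exact hS.sub hD
  have hsum : hS.lift = hD.lift + hL.lift := by
    funext i j
    refine SmoothFun.ext ?_
    change (fs - fs') i j = (dPrime (u' - u) + lam (w' - w)) i j
    rw [hfs]
  rw [hsum, contr_add, contr_rotOp_dPrime hU _ fun i j => rfl,
    contr_rotOp_lam hW _ fun i j => rfl, add_zero]

end Uniqueness

end MixedRay

theorem mainTheorem1 (k ℓ : ℕ) (hkℓ : 1 ≤ k ∨ ℓ = 0) (f : MixedRay.TField k ℓ)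
    (hf : MixedRay.IsSmoothSymCompact f) :
    ∃ fs : MixedRay.TField k ℓ, MixedRay.IsSolenoidalPart f fs ∧
      (∀ fs' : MixedRay.TField k ℓ, MixedRay.IsSolenoidalPart f fs' → fs' = fs) ∧
      ∀ (m : MixedRay.Idx k) (n : MixedRay.Idx ℓ),
        MixedRay.IsFourierMultiplier
          (fun ξ =>
            (1 / (4 * (Real.pi : ℂ))) * (-1) ^ MixedRay.numTwos m *
              MixedRay.symSqrtLaplacian ξ *
              (MixedRay.symD 0 ξ ^ MixedRay.numTwos n *
                MixedRay.symD 1 ξ ^ MixedRay.numTwos m)⁻¹ *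
              (MixedRay.symD 0 ξ ^ MixedRay.numTwos m *
                MixedRay.symD 1 ξ ^ MixedRay.numTwos n))
          (MixedRay.normalOp f (fun _ => 0) (fun _ => 0)) (fs m n) := by
  exact ⟨_, MixedRay.isSolenoidalPart_solPart hkℓ hf,
    fun _ h' => (MixedRay.isSolenoidalPart_solPart hkℓ hf).unique h',
    fun m n => MixedRay.isFourierMultiplier_normalOp hf m n⟩
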